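/- All graphs are finite, simple and undirected, and are considered up to isomorphism. Contracting an edge $\{u,v\}$ of a graph means deleting $u$ and $v$ and adding a new vertex adjacent to exactly the remaining vertices that were adjacent to $u$ or to $v$. A graph $H$ is a *contraction* of a graph $G$ if $H$ can be obtained from $G$ by a finite (possibly empty) sequence of edge contractions; $G$ is *$H$-contraction-free* if $H$ is not a contraction of $G$. A class of graphs is *well-quasi-ordered by contractions* if, with respect to the quasi-order "is a contraction of", it contains neither an infinite strictly decreasing sequence nor an infinite set of pairwise incomparable graphs. The *diamond* is the graph obtained from the complete graph $K_4$ by deleting one edge. **Theorem.** Let $H$ be a graph. The class of connected $H$-contraction-free graphs is well-quasi-ordered by contractions if and only if $H$ is a contraction of the diamond. -/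

import Mathlib

/-- A finite simple undirected graph. -/
structure FinGraph where
  V : Type
  [finite : Finite V]
  graph : SimpleGraph V

attribute [instance] FinGraph.finite

/-- The graph obtained by merging `u` and `v`: both are deleted, and a new vertex (`none`) is added
that is adjacent to the remaining neighbors of `u` and of `v`. -/
def SimpleGraph.contractPair {V : Type} (G : SimpleGraph V) (u v : V) :
    SimpleGraph (Option {x : V // x ≠ u ∧ x ≠ v}) where
  Adj
    | some x, some y => G.Adj x y
    | none, some y => G.Adj u y ∨ G.Adj v y
    | some x, none => G.Adj u x ∨ G.Adj v x
    | none, none => False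
  symm := ⟨fun a b h => by
    cases a <;> cases b
    · exact h
    · exact h
    · exact h
    · exact G.adj_symm h⟩
  loopless := ⟨fun a h => by
    cases a
    · exact h
    · exact G.loopless.irrefl _ h⟩

namespace FinGraph

/-- The graphs `G` and `G'` are isomorphic. -/
def Isomorphic (G G' : FinGraph) : Prop := Nonempty (G.graph ≃g G'.graph)

/-- `G'` is obtained from `G` by contracting one edge. -/
def IsEdgeContraction (G G' : FinGraph) : Prop :=
  ∃ u v : G.V, G.graph.Adj u v ∧ G' = ⟨_, G.graph.contractPair u v⟩

/-- `H` is a contraction of `G`: it is obtained from `G` by a finite, possibly empty sequence of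
edge contractions, where graphs are identified up to isomorphism. -/
def IsContraction (H G : FinGraph) : Prop :=
  Relation.ReflTransGen (fun A B => Isomorphic A B ∨ IsEdgeContraction A B) G H

/-- Finite graphs are quasi-ordered by contraction: `H ≤ G` if `H` is a contraction of `G`. -/
instance : Preorder FinGraph where
  le := IsContraction
  le_refl _ := Relation.ReflTransGen.refl
  le_trans _ _ _ h₁ h₂ := Relation.ReflTransGen.trans h₂ h₁

/-- The class of connected graphs that do not contain `H` as a contraction. -/
def connectedContractionFree (H : FinGraph) : Set FinGraph :=
  {G | G.graph.Connected ∧ ¬ IsContraction H G}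

/-- The diamond: the complete graph on four vertices minus one edge. -/
def diamond : FinGraph := ⟨Fin 4, (⊤ : SimpleGraph (Fin 4)).deleteEdges {s(0, 1)}⟩

end FinGraph

/-! Contractions are handled as maps: `H` is a contraction of `G` exactly when some surjection `G →
H` has connected fibres and makes distinct vertices of `H` adjacent precisely when there is an edge
between their fibres (`isContraction_iff`).

Sufficiency. It is enough to treat the diamond, since excluding one of its contractions only shrinks
the class. In a connected graph, four disjoint connected sets with the adjacencies of the diamond
can be grown until they cover everything, so a diamond-contraction-free graph contains no such sets
at all. Given a root `r` and an edge `rs`, either `rs` is a bridge, or a shortest cycle through `rs`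
is a triangle, which extends to a maximal clique, or it is a longer induced cycle. In the last two
cases a connected set off this core touching two core vertices would produce a diamond model. Hence
the graph is a clique or cycle with smaller connected rooted graphs hanging at its vertices
(`exists_isDecomposition_coreGraph`). Listing these pieces along the core, Higman's lemma and a
Nash-Williams minimal bad sequence give the well-quasi-order on rooted graphs: an increasing
embedding of index sets yields a contraction of cores, and the unused pieces are swallowed by it.

Necessity. The graphs `K_{2,n}`, and the complements of long cycles, form two sequences in which no
member is a contraction of a later one. So `H` is a proper contraction of some `K_{2,n}`, and
therefore consists of one or two universal vertices and an independent set; it is also a contraction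
of the complement of a long cycle, so it has no three independent vertices. What remains are
contractions of the diamond. -/

namespace SimpleGraph

/-! ### Contraction maps -/

variable {V W X : Type*}

/-- The spanning subgraph of `G` formed by the edges inside the fibres of `φ`. -/
def fiberGraph (G : SimpleGraph V) (φ : V → W) : SimpleGraph V where
  Adj x y := G.Adj x y ∧ φ x = φ y
  symm := ⟨fun _ _ h => ⟨h.1.symm, h.2.symm⟩⟩
  loopless := ⟨fun _ h => G.loopless.irrefl _ h.1⟩

/-- `φ` exhibits `H` as the graph obtained from `G` by contracting the fibres of `φ`, which are
connected. -/
structure IsContractionMap (G : SimpleGraph V) (H : SimpleGraph W) (φ : V → W) : Prop where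
  surj : Function.Surjective φ
  conn : ∀ x y, φ x = φ y → (G.fiberGraph φ).Reachable x y
  map_adj : ∀ x y, G.Adj x y → φ x ≠ φ y → H.Adj (φ x) (φ y)
  lift_adj : ∀ u v, H.Adj u v → ∃ x y, φ x = u ∧ φ y = v ∧ G.Adj x y

theorem fiberGraph_le (G : SimpleGraph V) (φ : V → W) : G.fiberGraph φ ≤ G :=
  fun _ _ h => h.1

theorem fiberGraph_le_comp (G : SimpleGraph V) (φ : V → W) (ψ : W → X) :
    G.fiberGraph φ ≤ G.fiberGraph (ψ ∘ φ) :=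
  fun _ _ h => ⟨h.1, congrArg ψ h.2⟩

/-- A property that is preserved along edges is preserved along walks. -/
theorem Reachable.of_adj_closed {G : SimpleGraph V} {p : V → Prop}
    (h : ∀ x y, G.Adj x y → p x → p y) {x y : V} (hxy : G.Reachable x y) (hx : p x) : p y := by
  rw [reachable_iff_reflTransGen] at hxy
  induction hxy with
  | refl => exact hx
  | tail _ hab ih => exact h _ _ hab ih

/-- Reachability is transported by a map that sends edges to reachable pairs. -/
theorem Reachable.map_of_adj {G : SimpleGraph V} {H : SimpleGraph W} (φ : V → W)
    (h : ∀ x y, G.Adj x y → H.Reachable (φ x) (φ y)) {x y : V} (hxy : G.Reachable x y) :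
    H.Reachable (φ x) (φ y) :=
  hxy.of_adj_closed (p := fun z => H.Reachable (φ x) (φ z))
    (fun _ _ hab ha => ha.trans (h _ _ hab)) (Reachable.refl _)

theorem Reachable.fiber_eq {G : SimpleGraph V} {φ : V → W} {x y : V}
    (h : (G.fiberGraph φ).Reachable x y) : φ x = φ y :=
  h.of_adj_closed (p := fun z => φ x = φ z)
    (fun _ _ (hab : (G.fiberGraph φ).Adj _ _) ha => ha.trans hab.2) rfl

namespace IsContractionMap

variable {G : SimpleGraph V} {H : SimpleGraph W} {K : SimpleGraph X}

theorem of_iso (e : G ≃g H) : IsContractionMap G H e where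
  surj := e.surjective
  conn x y h := by rw [e.injective h]
  map_adj x y h _ := e.map_adj_iff.2 h
  lift_adj u v h := ⟨e.symm u, e.symm v, by simp, by simp, e.symm.map_adj_iff.2 h⟩

/-- Paths in a contraction lift. -/
theorem reachable_lift {φ : V → W} (hφ : IsContractionMap G H φ) (ψ : W → X) {u v : W}
    (h : (H.fiberGraph ψ).Reachable u v) (x y : V) (hx : φ x = u) (hy : φ y = v) :
    (G.fiberGraph (ψ ∘ φ)).Reachable x y := by
  refine h.of_adj_closed (p := fun v => ∀ y, φ y = v → (G.fiberGraph (ψ ∘ φ)).Reachable x y)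
    ?_ ?_ y hy
  · intro w w' hw ih y hy
    obtain ⟨a, b, ha, hb, hab⟩ := hφ.lift_adj _ _ hw.1
    refine (ih a ha).trans (Reachable.trans (v := b) (Adj.reachable ⟨hab, ?_⟩) ?_)
    · simpa [ha, hb] using hw.2
    · exact (hφ.conn _ _ (hb.trans hy.symm)).mono (fiberGraph_le_comp G φ ψ)
  · intro y hy
    exact (hφ.conn _ _ (hx.trans hy.symm)).mono (fiberGraph_le_comp G φ ψ)

theorem comp {φ : V → W} {ψ : W → X} (hψ : IsContractionMap H K ψ)
    (hφ : IsContractionMap G H φ) : IsContractionMap G K (ψ ∘ φ) where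
  surj := hψ.surj.comp hφ.surj
  conn x y h := hφ.reachable_lift ψ (hψ.conn _ _ h) x y rfl rfl
  map_adj x y h hne :=
    hψ.map_adj _ _ (hφ.map_adj _ _ h fun e => hne (congrArg ψ e)) hne
  lift_adj u v h := by
    obtain ⟨a, b, rfl, rfl, hab⟩ := hψ.lift_adj _ _ h
    obtain ⟨x, y, rfl, rfl, hxy⟩ := hφ.lift_adj _ _ hab
    exact ⟨x, y, rfl, rfl, hxy⟩

/-- A contraction map that factors through another one induces a contraction map. -/
theorem of_comp {φ : V → W} {ψ : W → X} (hφ : IsContractionMap G H φ)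
    (h : IsContractionMap G K (ψ ∘ φ)) : IsContractionMap H K ψ where
  surj := h.surj.of_comp
  conn u v huv := by
    obtain ⟨x, rfl⟩ := hφ.surj u
    obtain ⟨y, rfl⟩ := hφ.surj v
    refine (h.conn x y huv).map_of_adj φ fun a b hab => ?_
    by_cases e : φ a = φ b
    · rw [e]
    · exact Adj.reachable ⟨hφ.map_adj _ _ hab.1 e, hab.2⟩
  map_adj u v huv hne := by
    obtain ⟨x, y, rfl, rfl, hxy⟩ := hφ.lift_adj _ _ huv
    exact h.map_adj x y hxy hne
  lift_adj u v huv := by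
    obtain ⟨x, y, rfl, rfl, hxy⟩ := h.lift_adj _ _ huv
    refine ⟨φ x, φ y, rfl, rfl, hφ.map_adj _ _ hxy fun e => huv.ne (congrArg ψ e)⟩

theorem reachable_map {φ : V → W} (hφ : IsContractionMap G H φ) {x y : V}
    (h : G.Reachable x y) : H.Reachable (φ x) (φ y) := by
  refine h.map_of_adj φ fun a b hab => ?_
  by_cases e : φ a = φ b
  · rw [e]
  · exact (hφ.map_adj _ _ hab e).reachable

theorem connected {φ : V → W} (hφ : IsContractionMap G H φ) (h : G.Connected) :
    H.Connected := by
  have := h.nonempty.map φ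
  refine ⟨fun u v => ?_⟩
  obtain ⟨x, rfl⟩ := hφ.surj u
  obtain ⟨y, rfl⟩ := hφ.surj v
  exact hφ.reachable_map (h x y)

/-- The contraction of a connected graph to a single vertex. -/
theorem of_subsingleton [Nonempty W] [Subsingleton W] (hG : G.Connected) (φ : V → W) :
    IsContractionMap G H φ where
  surj := have := hG.nonempty; Function.surjective_to_subsingleton φ
  conn x y _ := (hG x y).mono fun _ _ hab => ⟨hab, Subsingleton.elim _ _⟩
  map_adj _ _ _ h := (h (Subsingleton.elim _ _)).elim
  lift_adj _ _ h := (h.ne (Subsingleton.elim _ _)).elim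

end IsContractionMap

open Classical in
/-- The projection to the graph in which `u` and `v` are merged. -/
noncomputable def contractPairMap {V : Type} (u v : V) (x : V) :
    Option {x : V // x ≠ u ∧ x ≠ v} :=
  if h : x ≠ u ∧ x ≠ v then some ⟨x, h⟩ else none

theorem isContractionMap_contractPairMap {V : Type} {G : SimpleGraph V} {u v : V}
    (huv : G.Adj u v) : IsContractionMap G (G.contractPair u v) (contractPairMap u v) := by
  have some_iff : ∀ x z, contractPairMap u v x = some z ↔ x = z.1 := by
    intro x z
    unfold contractPairMap
    split_ifs with h
    · simp [Subtype.ext_iff]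
    · simp only [false_iff]
      rintro rfl
      exact h z.2
  have none_iff : ∀ x, contractPairMap u v x = none ↔ x = u ∨ x = v := by
    intro x
    unfold contractPairMap
    split_ifs with h
    · simpa using h
    · simp only [true_iff]
      tauto
  have hu := (none_iff u).2 (Or.inl rfl)
  have hv := (none_iff v).2 (Or.inr rfl)
  refine ⟨fun z => ?_, fun x y h => ?_, fun x y h hne => ?_, fun a b h => ?_⟩
  · cases z with
    | none => exact ⟨u, hu⟩
    | some z => exact ⟨z.1, (some_iff _ _).2 rfl⟩
  · cases hx : contractPairMap u v x with
    | some z =>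
      rw [hx] at h
      rw [(some_iff _ _).1 hx, (some_iff _ _).1 h.symm]
    | none =>
      rw [hx] at h
      have key : (G.fiberGraph (contractPairMap u v)).Adj u v := ⟨huv, hu.trans hv.symm⟩
      rcases (none_iff _).1 hx with rfl | rfl <;> rcases (none_iff _).1 h.symm with rfl | rfl
      · rfl
      · exact key.reachable
      · exact key.symm.reachable
      · rfl
  · cases hx : contractPairMap u v x with
    | none =>
      cases hy : contractPairMap u v y with
      | none => exact (hne (hx.trans hy.symm)).elim
      | some w =>
        obtain rfl := (some_iff _ _).1 hy
        rcases (none_iff _).1 hx with rfl | rfl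
        · exact Or.inl h
        · exact Or.inr h
    | some z =>
      obtain rfl := (some_iff _ _).1 hx
      cases hy : contractPairMap u v y with
      | none =>
        rcases (none_iff _).1 hy with rfl | rfl
        · exact Or.inl h.symm
        · exact Or.inr h.symm
      | some w =>
        obtain rfl := (some_iff _ _).1 hy
        exact h
  · cases a with
    | none =>
      cases b with
      | none => exact h.elim
      | some w =>
        rcases h with h | h
        · exact ⟨u, w, hu, (some_iff _ _).2 rfl, h⟩
        · exact ⟨v, w, hv, (some_iff _ _).2 rfl, h⟩
    | some z =>
      cases b with
      | none =>
        rcases h with h | h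
        · exact ⟨z, u, (some_iff _ _).2 rfl, hu, h.symm⟩
        · exact ⟨z, v, (some_iff _ _).2 rfl, hv, h.symm⟩
      | some w => exact ⟨z, w, (some_iff _ _).2 rfl, (some_iff _ _).2 rfl, h⟩

end SimpleGraph

namespace FinGraph

open SimpleGraph

/-- Induction on the number of vertices. If `φ` is not injective, a nontrivial connected fibre
contains an edge `uv`; `φ` factors through the contraction of that edge, and the remaining factor is
again a contraction map, from a smaller graph. -/
theorem isContraction_of_map (n : ℕ) : ∀ {V W : Type} [Finite V] [Finite W] {G : SimpleGraph V}
    {H : SimpleGraph W} {φ : V → W}, Nat.card V = n → IsContractionMap G H φ →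
    IsContraction ⟨W, H⟩ ⟨V, G⟩ := by
  induction n using Nat.strong_induction_on with
  | _ n ih =>
    intro V W _ _ G H φ hn hφ
    by_cases hinj : Function.Injective φ
    · refine Relation.ReflTransGen.single (Or.inl ⟨⟨Equiv.ofBijective φ ⟨hinj, hφ.surj⟩, ?_⟩⟩)
      intro a b
      constructor
      · intro h
        obtain ⟨x, y, hx, hy, hxy⟩ := hφ.lift_adj _ _ h
        rwa [← hinj hx, ← hinj hy]
      · intro h
        exact hφ.map_adj _ _ h (hinj.ne h.ne)
    · obtain ⟨u, v, huv, huv'⟩ : ∃ u v, G.Adj u v ∧ φ u = φ v := by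
        by_contra! hcon
        refine hinj fun x y hxy => ?_
        refine (hφ.conn x y hxy).of_adj_closed (p := fun z => x = z) ?_ rfl
        rintro a b hab rfl
        exact (hcon _ _ hab.1 hab.2).elim
      have hq := isContractionMap_contractPairMap huv
      let ψ : Option {x : V // x ≠ u ∧ x ≠ v} → W := fun o => o.elim (φ u) fun x => φ x
      have hψ : ψ ∘ contractPairMap u v = φ := by
        funext x
        by_cases h : x ≠ u ∧ x ≠ v
        · simp [ψ, contractPairMap, h]
        · simp only [Function.comp, contractPairMap, h, dite_false, ψ, Option.elim]
          by_cases hu : x = u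
          · rw [hu]
          · rw [show x = v by tauto, huv']
      have hfac := hq.of_comp (ψ := ψ) (K := H) (by rwa [hψ])
      have hcard : Nat.card (Option {x : V // x ≠ u ∧ x ≠ v}) < n := by
        rw [← hn]
        refine (Nat.card_le_card_of_surjective _ hq.surj).lt_of_ne fun e => huv.ne ?_
        refine (hq.surj.bijective_of_nat_card_le e.ge).injective ?_
        simp [contractPairMap]
      refine Relation.ReflTransGen.head (Or.inr ⟨u, v, huv, rfl⟩) (ih _ hcard rfl hfac)

/-- Contractions are given by contraction maps. -/
theorem isContraction_iff {H G : FinGraph} :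
    IsContraction H G ↔ ∃ φ : G.V → H.V, IsContractionMap G.graph H.graph φ := by
  constructor
  · intro h
    induction h with
    | refl => exact ⟨id, .of_iso (Iso.refl)⟩
    | tail _ hab ih =>
      obtain ⟨φ, hφ⟩ := ih
      rcases hab with ⟨⟨e⟩⟩ | ⟨u, v, huv, rfl⟩
      · exact ⟨_, (IsContractionMap.of_iso e).comp hφ⟩
      · exact ⟨_, (isContractionMap_contractPairMap huv).comp hφ⟩
  · rintro ⟨φ, hφ⟩
    exact isContraction_of_map _ rfl hφ

end FinGraph

/-! ### Diamond models and their enlargement -/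

namespace SimpleGraph

variable {V W : Type*} {G : SimpleGraph V}

theorem reachable_of_induce {S : Set V} {H : SimpleGraph V}
    (hH : ∀ x ∈ S, ∀ y ∈ S, G.Adj x y → H.Adj x y) (h : (G.induce S).Preconnected) {x y : V}
    (hx : x ∈ S) (hy : y ∈ S) : H.Reachable x y :=
  (h ⟨x, hx⟩ ⟨y, hy⟩).map_of_adj Subtype.val fun a b hab =>
    (hH a a.2 b b.2 hab).reachable

theorem connected_induce_insert {S : Set V} {x s : V} (hS : (G.induce S).Connected) (hs : s ∈ S)
    (h : G.Adj x s) : (G.induce (insert x S)).Connected := by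
  have := connected_induce_union (s := {x}) (t := S) Preconnected.of_subsingleton
    hS.preconnected rfl hs h
  rwa [Set.singleton_union] at this

theorem connected_induce_singleton (x : V) : (G.induce {x}).Connected :=
  Connected.of_subsingleton

theorem connected_induce_union' {S T : Set V} (hS : (G.induce S).Connected)
    (hT : (G.induce T).Connected) (h : ∃ s ∈ S, ∃ t ∈ T, G.Adj s t) :
    (G.induce (S ∪ T)).Connected := by
  obtain ⟨s, hs, t, ht, hst⟩ := h
  exact connected_induce_union hS.preconnected hT.preconnected hs ht hst

theorem exists_mem_of_connected_induce {S : Set V} (h : (G.induce S).Connected) : ∃ x, x ∈ S :=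
  let ⟨x⟩ := h.nonempty
  ⟨x.1, x.2⟩

/-- A map with connected fibres that respects adjacency is a contraction map. -/
theorem isContractionMap_of_fibers {H : SimpleGraph W} {φ : V → W}
    (hφ : ∀ u, (G.induce (φ ⁻¹' {u})).Connected)
    (map_adj : ∀ x y, G.Adj x y → φ x ≠ φ y → H.Adj (φ x) (φ y))
    (lift_adj : ∀ u v, H.Adj u v → ∃ x y, φ x = u ∧ φ y = v ∧ G.Adj x y) :
    IsContractionMap G H φ where
  surj u := exists_mem_of_connected_induce (hφ u)
  conn x y hxy := by
    refine reachable_of_induce (S := φ ⁻¹' {φ y}) ?_ (hφ _).preconnected hxy rfl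
    intro a ha b hb hab
    exact ⟨hab, ha.trans hb.symm⟩
  map_adj := map_adj
  lift_adj := lift_adj

/-- Four disjoint connected sets whose adjacencies are those of the diamond, in which `A` and `B`
are not adjacent. -/
structure IsDiamondModel (G : SimpleGraph V) (A B C D : Set V) : Prop where
  connA : (G.induce A).Connected
  connB : (G.induce B).Connected
  connC : (G.induce C).Connected
  connD : (G.induce D).Connected
  disjAB : Disjoint A B
  disjAC : Disjoint A C
  disjAD : Disjoint A D
  disjBC : Disjoint B C
  disjBD : Disjoint B D
  disjCD : Disjoint C D
  adjAC : ∃ a ∈ A, ∃ c ∈ C, G.Adj a c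
  adjAD : ∃ a ∈ A, ∃ d ∈ D, G.Adj a d
  adjBC : ∃ b ∈ B, ∃ c ∈ C, G.Adj b c
  adjBD : ∃ b ∈ B, ∃ d ∈ D, G.Adj b d
  adjCD : ∃ c ∈ C, ∃ d ∈ D, G.Adj c d
  not_adj : ∀ a ∈ A, ∀ b ∈ B, ¬ G.Adj a b

theorem exists_adj_symm {S T : Set V} (h : ∃ s ∈ S, ∃ t ∈ T, G.Adj s t) :
    ∃ t ∈ T, ∃ s ∈ S, G.Adj t s :=
  let ⟨s, hs, t, ht, hst⟩ := h
  ⟨t, ht, s, hs, hst.symm⟩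

theorem exists_adj_mono {S T S' T' : Set V} (h : ∃ s ∈ S, ∃ t ∈ T, G.Adj s t) (hS : S ⊆ S')
    (hT : T ⊆ T') : ∃ s ∈ S', ∃ t ∈ T', G.Adj s t :=
  let ⟨s, hs, t, ht, hst⟩ := h
  ⟨s, hS hs, t, hT ht, hst⟩

namespace IsDiamondModel

variable {A B C D : Set V}

theorem swapAB (h : IsDiamondModel G A B C D) : IsDiamondModel G B A C D where
  connA := h.connB
  connB := h.connA
  connC := h.connC
  connD := h.connD
  disjAB := h.disjAB.symm
  disjAC := h.disjBC
  disjAD := h.disjBD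
  disjBC := h.disjAC
  disjBD := h.disjAD
  disjCD := h.disjCD
  adjAC := h.adjBC
  adjAD := h.adjBD
  adjBC := h.adjAC
  adjBD := h.adjAD
  adjCD := h.adjCD
  not_adj a ha b hb hab := h.not_adj b hb a ha hab.symm

theorem swapCD (h : IsDiamondModel G A B C D) : IsDiamondModel G A B D C where
  connA := h.connA
  connB := h.connB
  connC := h.connD
  connD := h.connC
  disjAB := h.disjAB
  disjAC := h.disjAD
  disjAD := h.disjAC
  disjBC := h.disjBD
  disjBD := h.disjBC
  disjCD := h.disjCD.symm
  adjAC := h.adjAD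
  adjAD := h.adjAC
  adjBC := h.adjBD
  adjBD := h.adjBC
  adjCD := exists_adj_symm h.adjCD
  not_adj := h.not_adj

theorem insertC (h : IsDiamondModel G A B C D) {x c : V} (hc : c ∈ C) (hx : G.Adj x c)
    (hA : x ∉ A) (hB : x ∉ B) (hD : x ∉ D) : IsDiamondModel G A B (insert x C) D where
  connA := h.connA
  connB := h.connB
  connC := connected_induce_insert h.connC hc hx
  connD := h.connD
  disjAB := h.disjAB
  disjAC := Set.disjoint_insert_right.2 ⟨hA, h.disjAC⟩
  disjAD := h.disjAD
  disjBC := Set.disjoint_insert_right.2 ⟨hB, h.disjBC⟩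
  disjBD := h.disjBD
  disjCD := Set.disjoint_insert_left.2 ⟨hD, h.disjCD⟩
  adjAC := exists_adj_mono h.adjAC subset_rfl (Set.subset_insert x C)
  adjAD := h.adjAD
  adjBC := exists_adj_mono h.adjBC subset_rfl (Set.subset_insert x C)
  adjBD := h.adjBD
  adjCD := exists_adj_mono h.adjCD (Set.subset_insert x C) subset_rfl
  not_adj := h.not_adj

theorem insertA (h : IsDiamondModel G A B C D) {x a : V} (ha : a ∈ A) (hx : G.Adj x a)
    (hB : x ∉ B) (hC : x ∉ C) (hD : x ∉ D) (hxB : ∀ b ∈ B, ¬ G.Adj x b) :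
    IsDiamondModel G (insert x A) B C D where
  connA := connected_induce_insert h.connA ha hx
  connB := h.connB
  connC := h.connC
  connD := h.connD
  disjAB := Set.disjoint_insert_left.2 ⟨hB, h.disjAB⟩
  disjAC := Set.disjoint_insert_left.2 ⟨hC, h.disjAC⟩
  disjAD := Set.disjoint_insert_left.2 ⟨hD, h.disjAD⟩
  disjBC := h.disjBC
  disjBD := h.disjBD
  disjCD := h.disjCD
  adjAC := exists_adj_mono h.adjAC (Set.subset_insert x A) subset_rfl
  adjAD := exists_adj_mono h.adjAD (Set.subset_insert x A) subset_rfl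
  adjBC := h.adjBC
  adjBD := h.adjBD
  adjCD := h.adjCD
  not_adj := by
    rintro a (rfl | ha) b hb
    · exact hxB b hb
    · exact h.not_adj a ha b hb

/-- If a vertex `x` outside a diamond model is adjacent to `A` and `B` but not to `D`, then `x`
and `D` are the nonadjacent parts of another diamond model. -/
theorem subdivide (h : IsDiamondModel G A B C D) {x : V} (hA : x ∉ A) (hB : x ∉ B) (hC : x ∉ C)
    (hD : x ∉ D) (hxA : ∃ a ∈ A, G.Adj x a) (hxB : ∃ b ∈ B, G.Adj x b)
    (hxD : ∀ d ∈ D, ¬ G.Adj x d) : IsDiamondModel G {x} D (A ∪ C) B where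
  connA := connected_induce_singleton x
  connB := h.connD
  connC := connected_induce_union' h.connA h.connC h.adjAC
  connD := h.connB
  disjAB := Set.disjoint_singleton_left.2 hD
  disjAC := Set.disjoint_singleton_left.2 (by simp [hA, hC])
  disjAD := Set.disjoint_singleton_left.2 hB
  disjBC := Set.disjoint_union_right.2 ⟨h.disjAD.symm, h.disjCD.symm⟩
  disjBD := h.disjBD.symm
  disjCD := Set.disjoint_union_left.2 ⟨h.disjAB, h.disjBC.symm⟩
  adjAC := let ⟨a, ha, hxa⟩ := hxA; ⟨x, rfl, a, Or.inl ha, hxa⟩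
  adjAD := let ⟨b, hb, hxb⟩ := hxB; ⟨x, rfl, b, hb, hxb⟩
  adjBC := exists_adj_mono (exists_adj_symm h.adjCD) subset_rfl Set.subset_union_right
  adjBD := exists_adj_symm h.adjBD
  adjCD := exists_adj_mono (exists_adj_symm h.adjBC) Set.subset_union_right subset_rfl
  not_adj := by
    rintro _ rfl d hd
    exact hxD d hd

/-- A diamond model that does not cover a connected graph can be enlarged. -/
theorem exists_insert (h : IsDiamondModel G A B C D) (hG : G.Connected)
    (hne : A ∪ B ∪ C ∪ D ≠ Set.univ) : ∃ x ∉ A ∪ B ∪ C ∪ D, ∃ A' B' C' D',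
      IsDiamondModel G A' B' C' D' ∧ A' ∪ B' ∪ C' ∪ D' = insert x (A ∪ B ∪ C ∪ D) := by
  obtain ⟨x, hx, y, hy, hxy⟩ : ∃ x ∉ A ∪ B ∪ C ∪ D, ∃ y ∈ A ∪ B ∪ C ∪ D, G.Adj x y := by
    by_contra! hcon
    refine hne (Set.eq_univ_of_forall fun z => ?_)
    obtain ⟨a, ha⟩ := exists_mem_of_connected_induce h.connA
    refine (hG a z).of_adj_closed (p := (· ∈ A ∪ B ∪ C ∪ D)) ?_ (by simp [ha])
    intro u v huv hu
    by_contra hv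
    exact hcon v hv u hu huv.symm
  refine ⟨x, hx, ?_⟩
  simp only [Set.mem_union, not_or] at hx
  obtain ⟨⟨⟨hA, hB⟩, hC⟩, hD⟩ := hx
  -- `C` and `D` touch every other part, so either may absorb `x`. Otherwise `A` or `B` absorbs `x`,
  -- unless `x` touches both; then `subdivide` rearranges the parts.
  by_cases hxC : ∃ c ∈ C, G.Adj x c
  · obtain ⟨c, hc, hxc⟩ := hxC
    refine ⟨_, _, _, _, h.insertC hc hxc hA hB hD, ?_⟩
    ext; simp only [Set.mem_union, Set.mem_insert_iff]; tauto
  by_cases hxD : ∃ d ∈ D, G.Adj x d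
  · obtain ⟨d, hd, hxd⟩ := hxD
    refine ⟨_, _, _, _, h.swapCD.insertC hd hxd hA hB hC, ?_⟩
    ext; simp only [Set.mem_union, Set.mem_insert_iff]; tauto
  by_cases hxA : ∃ a ∈ A, G.Adj x a
  · by_cases hxB : ∃ b ∈ B, G.Adj x b
    · push Not at hxD
      refine ⟨_, _, _, _, h.subdivide hA hB hC hD hxA hxB hxD, ?_⟩
      ext; simp only [Set.mem_union, Set.mem_insert_iff, Set.mem_singleton_iff]; tauto
    · push Not at hxB
      obtain ⟨a, ha, hxa⟩ := hxA
      refine ⟨_, _, _, _, h.insertA ha hxa hB hC hD hxB, ?_⟩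
      ext; simp only [Set.mem_union, Set.mem_insert_iff]; tauto
  · have hxB : y ∈ B := by
      by_contra hyB
      push Not at hxA hxC hxD
      rcases hy with ((hy | hy) | hy) | hy
      · exact hxA y hy hxy
      · exact hyB hy
      · exact hxC y hy hxy
      · exact hxD y hy hxy
    push Not at hxA
    refine ⟨_, _, _, _, h.swapAB.insertA hxB hxy hA hC hD hxA, ?_⟩
    ext; simp only [Set.mem_union, Set.mem_insert_iff]; tauto

theorem exists_cover [Finite V] (hG : G.Connected) (h : IsDiamondModel G A B C D) :
    ∃ A B C D, IsDiamondModel G A B C D ∧ A ∪ B ∪ C ∪ D = Set.univ := by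
  induction hn : (A ∪ B ∪ C ∪ D)ᶜ.ncard using Nat.strong_induction_on generalizing A B C D with
  | _ n ih =>
    by_cases hne : A ∪ B ∪ C ∪ D = Set.univ
    · exact ⟨A, B, C, D, h, hne⟩
    · obtain ⟨x, hx, A', B', C', D', h', he⟩ := h.exists_insert hG hne
      refine ih _ ?_ h' rfl
      rw [he, ← hn]
      refine Set.ncard_lt_ncard ?_
      rw [Set.ssubset_iff_of_subset (Set.compl_subset_compl.2 (Set.subset_insert _ _))]
      exact ⟨x, hx, fun hc => hc (Set.mem_insert _ _)⟩

end IsDiamondModel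

end SimpleGraph

namespace FinGraph

open SimpleGraph

theorem diamond_adj (i j : Fin 4) : diamond.graph.Adj i j ↔ i ≠ j ∧ s(i, j) ≠ s(0, 1) := by
  simp [diamond, deleteEdges_adj]

/-- A model may be local: it grows to a partition of the connected graph, whose classes are then the
fibres over the four vertices. -/
theorem isContraction_diamond_of_model {V : Type} [Finite V] {G : SimpleGraph V}
    (hG : G.Connected) {A B C D : Set V} (h : IsDiamondModel G A B C D) :
    IsContraction diamond ⟨V, G⟩ := by
  classical
  obtain ⟨A, B, C, D, h, hcov⟩ := h.exists_cover hG
  rw [isContraction_iff]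
  let φ : V → Fin 4 := fun x => if x ∈ A then 0 else if x ∈ B then 1 else if x ∈ C then 2 else 3
  have hmem : ∀ x, x ∈ A ∨ x ∈ B ∨ x ∈ C ∨ x ∈ D := fun x => by
    have := hcov.ge (Set.mem_univ x)
    simpa [or_assoc] using this
  have dAB := Set.disjoint_left.1 h.disjAB
  have dAC := Set.disjoint_left.1 h.disjAC
  have dAD := Set.disjoint_left.1 h.disjAD
  have dBC := Set.disjoint_left.1 h.disjBC
  have dBD := Set.disjoint_left.1 h.disjBD
  have dCD := Set.disjoint_left.1 h.disjCD
  have h0 : ∀ x, x ∈ A → φ x = 0 := fun x hx => if_pos hx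
  have h1 : ∀ x, x ∈ B → φ x = 1 := fun x hx => by
    have : x ∉ A := fun e => dAB e hx
    simp [φ, hx, this]
  have h2 : ∀ x, x ∈ C → φ x = 2 := fun x hx => by
    have : x ∉ A := fun e => dAC e hx
    have : x ∉ B := fun e => dBC e hx
    simp [φ, *]
  have h3 : ∀ x, x ∈ D → φ x = 3 := fun x hx => by
    have : x ∉ A := fun e => dAD e hx
    have : x ∉ B := fun e => dBD e hx
    have : x ∉ C := fun e => dCD e hx
    simp [φ, *]
  have e0 : φ ⁻¹' {0} = A := by
    ext x; rcases hmem x with hx | hx | hx | hx <;> grind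
  have e1 : φ ⁻¹' {1} = B := by
    ext x; rcases hmem x with hx | hx | hx | hx <;> grind
  have e2 : φ ⁻¹' {2} = C := by
    ext x; rcases hmem x with hx | hx | hx | hx <;> grind
  have e3 : φ ⁻¹' {3} = D := by
    ext x; rcases hmem x with hx | hx | hx | hx <;> grind
  refine ⟨φ, isContractionMap_of_fibers (fun u => ?_) (fun x y hxy hne => ?_) fun u v huv => ?_⟩
  · change Fin 4 at u
    fin_cases u
    · exact e0 ▸ h.connA
    · exact e1 ▸ h.connB
    · exact e2 ▸ h.connC
    · exact e3 ▸ h.connD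
  · refine (diamond_adj _ _).2 ⟨hne, fun e => ?_⟩
    rcases Sym2.eq_iff.1 e with ⟨hx, hy⟩ | ⟨hx, hy⟩
    · exact h.not_adj x (e0 ▸ hx) y (e1 ▸ hy) hxy
    · exact h.not_adj y (e0 ▸ hy) x (e1 ▸ hx) hxy.symm
  · have key : ∀ {S T : Set V} {i j : Fin 4}, (∃ s ∈ S, ∃ t ∈ T, G.Adj s t) →
        (∀ x, x ∈ S → φ x = i) → (∀ x, x ∈ T → φ x = j) →
        (∃ x y, φ x = i ∧ φ y = j ∧ G.Adj x y) ∧ ∃ x y, φ x = j ∧ φ y = i ∧ G.Adj x y :=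
      fun ⟨s, hs, t, ht, hst⟩ hi hj =>
        ⟨⟨s, t, hi s hs, hj t ht, hst⟩, ⟨t, s, hj t ht, hi s hs, hst.symm⟩⟩
    have k02 := key h.adjAC h0 h2
    have k03 := key h.adjAD h0 h3
    have k12 := key h.adjBC h1 h2
    have k13 := key h.adjBD h1 h3
    have k23 := key h.adjCD h2 h3
    change Fin 4 at u v
    rw [diamond_adj] at huv
    fin_cases u <;> fin_cases v <;> first
      | exact k02.1 | exact k02.2 | exact k03.1 | exact k03.2 | exact k12.1 | exact k12.2
      | exact k13.1 | exact k13.2 | exact k23.1 | exact k23.2 | exact absurd huv (by decide)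

end FinGraph

/-! ### Graphs with pieces attached to a core -/

namespace SimpleGraph

variable {V V' I I' : Type*}

/-- `G` consists of the graph `R` on the core vertices `c i`, with the connected graph induced by
the fibre `π ⁻¹' {i}` attached at each `c i`. -/
structure IsDecomposition (G : SimpleGraph V) (R : SimpleGraph I) (π : V → I) (c : I → V) :
    Prop where
  map_core : ∀ i, π (c i) = i
  conn : ∀ i, (G.induce {x | π x = i}).Connected
  core_adj : ∀ i j, R.Adj i j ↔ G.Adj (c i) (c j)
  eq_core : ∀ x y, G.Adj x y → π x ≠ π y → x = c (π x)

namespace IsDecomposition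

variable {G : SimpleGraph V} {G' : SimpleGraph V'} {R : SimpleGraph I} {R' : SimpleGraph I'}
  {π : V → I} {π' : V' → I'} {c : I → V} {c' : I' → V'}

/-- A contraction map of cores, together with rooted contraction maps of selected parts, yields a
contraction map. -/
theorem exists_map (h : IsDecomposition G R π c) (h' : IsDecomposition G' R' π' c') {g : I' → I}
    (hg : IsContractionMap R' R g) {f : I → I'} (hf : ∀ i, g (f i) = i)
    (hφ : ∀ i, ∃ φ : {x | π' x = f i} → {x | π x = i},
      IsContractionMap (G'.induce {x | π' x = f i}) (G.induce {x | π x = i}) φ ∧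
        φ ⟨c' (f i), h'.map_core _⟩ = ⟨c i, h.map_core i⟩) :
    ∃ Φ : V' → V, IsContractionMap G' G Φ ∧ ∀ j, Φ (c' j) = c (g j) := by
  classical
  choose φ hφ hφc using hφ
  -- Selected parts, those with index in the range of `f`, are mapped by `φ`; every other part
  -- collapses to the core vertex that `g` assigns to it.
  let Φ : V' → V := fun x =>
    if e : π' x = f (g (π' x)) then φ (g (π' x)) ⟨x, e⟩ else c (g (π' x))
  have hΦ : ∀ i x (e : π' x = f i), Φ x = φ i ⟨x, e⟩ := by
    intro i x e
    obtain rfl : g (π' x) = i := by rw [e, hf]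
    exact dif_pos e
  have hΦ' : ∀ x, π' x ≠ f (g (π' x)) → Φ x = c (g (π' x)) := fun x e => dif_neg e
  have hπΦ : ∀ x, π (Φ x) = g (π' x) := by
    intro x
    by_cases e : π' x = f (g (π' x))
    · rw [hΦ _ x e]
      exact (φ (g (π' x)) ⟨x, e⟩).2
    · rw [hΦ' x e, h.map_core]
  have hΦc : ∀ j, Φ (c' j) = c (g j) := by
    intro j
    by_cases e : j = f (g j)
    · have := congrArg Subtype.val (hφc (g j))
      rw [← hΦ (g j) _ (h'.map_core _), ← e] at this
      exact this
    · rw [hΦ', h'.map_core]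
      rwa [h'.map_core]
  have hpart : ∀ i x y, π' x = f i → π' y = f i → Φ x = Φ y →
      (G'.fiberGraph Φ).Reachable x y := by
    intro i x y hx hy hxy
    rw [hΦ i x hx, hΦ i y hy] at hxy
    refine ((hφ i).conn ⟨x, hx⟩ ⟨y, hy⟩ (Subtype.ext hxy)).map_of_adj Subtype.val fun a b hab => ?_
    refine Adj.reachable ⟨hab.1, ?_⟩
    rw [hΦ i a a.2, hΦ i b b.2]
    exact congrArg Subtype.val hab.2
  have hcore : ∀ j j', (R'.fiberGraph g).Reachable j j' →
      (G'.fiberGraph Φ).Reachable (c' j) (c' j') := by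
    intro j j' hj
    refine hj.map_of_adj (H := G'.fiberGraph Φ) c' fun a b (hab : (R'.fiberGraph g).Adj a b) =>
      Adj.reachable ⟨(h'.core_adj a b).1 hab.1, ?_⟩
    rw [hΦc, hΦc, hab.2]
  -- A collapsed part lies in a single fibre: walk inside it to its core vertex, then along the core
  -- within a fibre of `g` to a selected part. Connectedness of fibres thus reduces to selected
  -- parts.
  have hmove : ∀ x, ∃ z, (G'.fiberGraph Φ).Reachable x z ∧ π' z = f (g (π' x)) := by
    intro x
    by_cases e : π' x = f (g (π' x))
    · exact ⟨x, .refl _, e⟩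
    · refine ⟨c' (f (g (π' x))), ?_, h'.map_core _⟩
      refine Reachable.trans (v := c' (π' x)) ?_ (hcore _ _ (hg.conn _ _ (hf _).symm))
      refine reachable_of_induce (S := {y | π' y = π' x}) ?_ (h'.conn _).preconnected rfl
        (h'.map_core _)
      rintro a (ha : π' a = π' x) b (hb : π' b = π' x) hab
      refine ⟨hab, ?_⟩
      rw [hΦ' a (by rwa [ha]), hΦ' b (by rwa [hb]), ha, hb]
  refine ⟨Φ, ⟨fun u => ?_, fun x y hxy => ?_, fun x y hxy hne => ?_, fun u v huv => ?_⟩, hΦc⟩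
  · obtain ⟨x, hx⟩ := (hφ (π u)).surj ⟨u, rfl⟩
    exact ⟨x.1, (hΦ _ x.1 x.2).trans (congrArg Subtype.val hx)⟩
  · obtain ⟨z, hxz, hz⟩ := hmove x
    obtain ⟨w, hyw, hw⟩ := hmove y
    refine hxz.trans (Reachable.trans ?_ hyw.symm)
    refine hpart (g (π' x)) z w hz ?_ ?_
    · rw [hw, ← hπΦ y, ← hxy, hπΦ x]
    · rw [← hxz.fiber_eq, ← hyw.fiber_eq, hxy]
  · by_cases e : π' x = π' y
    · by_cases e' : π' x = f (g (π' x))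
      · generalize g (π' x) = i at e'
        have ey : π' y = f i := e.symm.trans e'
        rw [hΦ i x e', hΦ i y ey] at hne ⊢
        exact (hφ i).map_adj ⟨x, e'⟩ ⟨y, ey⟩ hxy fun e'' => hne (congrArg Subtype.val e'')
      · exact (hne (by rw [hΦ' x e', hΦ' y (e ▸ e'), e])).elim
    · have hx := h'.eq_core x y hxy e
      have hy := h'.eq_core y x hxy.symm (Ne.symm e)
      rw [hx, hy, hΦc, hΦc] at hne ⊢
      refine (h.core_adj _ _).1 (hg.map_adj _ _ ((h'.core_adj _ _).2 ?_) fun e' => hne ?_)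
      · rwa [← hx, ← hy]
      · rw [e']
  · by_cases e : π u = π v
    · obtain ⟨x, y, hx, hy, hxy⟩ := (hφ (π u)).lift_adj ⟨u, rfl⟩ ⟨v, e.symm⟩ huv
      exact ⟨x, y, (hΦ _ x.1 x.2).trans (congrArg Subtype.val hx),
        (hΦ _ y.1 y.2).trans (congrArg Subtype.val hy), hxy⟩
    · have hu := h.eq_core u v huv e
      have hv := h.eq_core v u huv.symm (Ne.symm e)
      obtain ⟨j, j', hj, hj', hjj⟩ := hg.lift_adj (π u) (π v)
        ((h.core_adj _ _).2 (by rwa [← hu, ← hv]))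
      exact ⟨c' j, c' j', by rw [hΦc, hj, ← hu], by rw [hΦc, hj', ← hv],
        (h'.core_adj _ _).1 hjj⟩

/-- Contracting everything outside one part. -/
theorem exists_map_part (h : IsDecomposition G R π c) (hG : G.Connected) (i : I) :
    ∃ Φ : V → {x | π x = i}, IsContractionMap G (G.induce {x | π x = i}) Φ ∧
      ∀ j, Φ (c j) = ⟨c i, h.map_core i⟩ := by
  classical
  let Φ : V → {x | π x = i} := fun x => if e : π x = i then ⟨x, e⟩ else ⟨c i, h.map_core i⟩
  have h1 : ∀ x (e : π x = i), Φ x = ⟨x, e⟩ := fun x e => dif_pos e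
  have h2 : ∀ x, π x ≠ i → Φ x = ⟨c i, h.map_core i⟩ := fun x e => dif_neg e
  have hreach : ∀ x, (G.fiberGraph Φ).Reachable (Φ x) x := by
    intro x
    by_cases e : π x = i
    · rw [h1 x e]
    -- Follow a walk from `c i`. It can leave part `i` only at `c i`, so every vertex met outside
    -- the part is joined to `c i` within the fibre.
    · refine ((hG (c i) x).of_adj_closed
        (p := fun z => π z = i ∨ (G.fiberGraph Φ).Reachable (c i) z) ?_
        (Or.inr (.refl _))).elim (fun e' => (e e').elim) (fun hr => by rwa [h2 x e])
      intro a b hab ha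
      by_cases hb : π b = i
      · exact Or.inl hb
      right
      by_cases hai : π a = i
      · have hac := h.eq_core a b hab (by rw [hai]; exact Ne.symm hb)
        rw [hai] at hac
        subst hac
        refine Adj.reachable ⟨hab, ?_⟩
        rw [h1 _ hai, h2 _ hb]
      · refine (ha.resolve_left hai).trans (Adj.reachable ⟨hab, ?_⟩)
        rw [h2 _ hai, h2 _ hb]
  refine ⟨Φ, ⟨fun u => ⟨u, h1 u u.2⟩, fun x y hxy => ?_, fun x y hxy hne => ?_,
    fun u v huv => ⟨u, v, h1 u u.2, h1 v v.2, huv⟩⟩, fun j => ?_⟩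
  · refine (hreach x).symm.trans ?_
    rw [hxy]
    exact hreach y
  · by_cases hx : π x = i
    · by_cases hy : π y = i
      · rw [h1 x hx, h1 y hy]
        exact hxy
      · have hxc := h.eq_core x y hxy (by rw [hx]; exact Ne.symm hy)
        rw [h1 x hx, h2 y hy] at hne
        exact (hne (Subtype.ext (hx ▸ hxc))).elim
    · by_cases hy : π y = i
      · have hyc := h.eq_core y x hxy.symm (by rw [hy]; exact Ne.symm hx)
        rw [h1 y hy, h2 x hx] at hne
        exact (hne (Subtype.ext (hy ▸ hyc).symm)).elim
      · exact (hne (by rw [h2 x hx, h2 y hy])).elim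
  · by_cases e : j = i
    · subst e
      exact h1 _ (h.map_core j)
    · exact h2 _ (by rwa [h.map_core])

end IsDecomposition

/-! ### Contractions between cliques and between cycles -/

/-- The complete graph on `Fin (k + 1)` or, if `cyc` holds, the cycle. -/
def coreGraph (cyc : Prop) (k : ℕ) : SimpleGraph (Fin (k + 1)) where
  Adj i j := i ≠ j ∧ (cyc → i.val + 1 = j ∨ j.val + 1 = i ∨ (i.val = 0 ∧ j.val = k) ∨
    (i.val = k ∧ j.val = 0))
  symm := ⟨fun _ _ h => ⟨h.1.symm, fun hc => by have := h.2 hc; omega⟩⟩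
  loopless := ⟨fun _ h => h.1 rfl⟩

/-- A strictly increasing map fixing `0` is a section of a contraction map of cores. -/
theorem exists_isContractionMap_coreGraph (cyc : Prop) {k k' : ℕ} {f : Fin (k + 1) → Fin (k' + 1)}
    (hf : StrictMono f) (hf0 : f 0 = 0) :
    ∃ g, IsContractionMap (coreGraph cyc k') (coreGraph cyc k) g ∧ ∀ i, g (f i) = i := by
  classical
  -- The retraction `g` is the upper adjoint of `f`: `g j` is the largest `i` with `f i ≤ j`, which
  -- exists because `f 0 = 0`. Its fibres are the intervals starting at the values of `f`.
  have hex : ∀ j, ∃ m, ∀ i, f i ≤ j ↔ i ≤ m := by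
    intro j
    let s : Finset (Fin (k + 1)) := Finset.univ.filter fun i => f i ≤ j
    have hs : s.Nonempty := ⟨0, by simp [s, hf0]⟩
    refine ⟨s.max' hs, fun i => ⟨fun h => s.le_max' i (by simp [s, h]), fun h => ?_⟩⟩
    have := s.max'_mem hs
    simp only [s, Finset.mem_filter, Finset.mem_univ, true_and] at this
    exact (hf.monotone h).trans this
  choose g hg using hex
  have hgf : ∀ i, g (f i) = i := fun i =>
    le_antisymm (hf.le_iff_le.1 ((hg _ _).2 le_rfl)) ((hg _ _).1 le_rfl)
  have hfg : ∀ j, f (g j) ≤ j := fun j => (hg _ _).2 le_rfl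
  have hmono : Monotone g := fun j j' h => (hg _ _).1 ((hfg j).trans h)
  have hstep : ∀ x y : Fin (k' + 1), x.val + 1 = y → (g y).val ≤ (g x).val + 1 := by
    intro x y hxy
    by_contra! hlt
    let i : Fin (k + 1) := ⟨(g x).val + 1, by omega⟩
    have h1 : f i < f (g y) := hf (by rw [Fin.lt_def]; exact hlt)
    have h2 : i ≤ g x := (hg _ _).1 (by
      have := hfg y
      rw [Fin.le_def] at *
      rw [Fin.lt_def] at h1
      omega)
    rw [Fin.le_def] at h2
    simp [i] at h2
  have hg0 : ∀ x : Fin (k' + 1), x.val = 0 → (g x).val = 0 := by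
    intro x hx
    have : x = f 0 := by rw [hf0]; exact Fin.ext hx
    rw [this, hgf]
    rfl
  -- Together with `hg0`, this sends the closing edge of the long cycle to the closing pair of the
  -- short one.
  have hgk : ∀ x : Fin (k' + 1), x.val = k' → (g x).val = k := by
    intro x hx
    have : Fin.last k ≤ g x := (hg _ _).1 (by rw [Fin.le_def]; omega)
    rw [Fin.le_def, Fin.val_last] at this
    omega
  have hconn : ∀ n : ℕ, ∀ y : Fin (k' + 1), y.val = (f (g y)).val + n →
      ((coreGraph cyc k').fiberGraph g).Reachable (f (g y)) y := by
    intro n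
    induction n with
    | zero =>
      intro y hy
      rw [show f (g y) = y from Fin.ext hy.symm]
    | succ n ih =>
      intro y hy
      let x : Fin (k' + 1) := ⟨y.val - 1, by omega⟩
      have hxv : x.val = y.val - 1 := rfl
      have hxy : g x = g y := by
        refine le_antisymm (hmono (by rw [Fin.le_def]; omega)) ((hg _ _).1 ?_)
        rw [Fin.le_def]
        omega
      have := ih x (by rw [hxy]; omega)
      rw [hxy] at this
      refine this.trans (Adj.reachable ⟨⟨?_, fun _ => Or.inl (by omega)⟩, hxy⟩)
      intro e
      rw [Fin.ext_iff] at e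
      omega
  have hconn' : ∀ y, ((coreGraph cyc k').fiberGraph g).Reachable (f (g y)) y := fun y =>
    hconn (y.val - (f (g y)).val) y (by have := hfg y; rw [Fin.le_def] at this; omega)
  have hlift : ∀ u v : Fin (k + 1), cyc → (u.val + 1 = v ∨ (u.val = 0 ∧ v.val = k)) → u ≠ v →
      ∃ x y, g x = u ∧ g y = v ∧ (coreGraph cyc k').Adj x y := by
    rintro u v hc (h | h) huv
    -- The last index before `f v` is still in the interval of `u`, so the edge crosses from one
    -- fibre to the next.
    · let x : Fin (k' + 1) := ⟨(f v).val - 1, by omega⟩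
      have hxv : x.val = (f v).val - 1 := rfl
      have huv : f u < f v := hf (by rw [Fin.lt_def]; omega)
      rw [Fin.lt_def] at huv
      refine ⟨x, f v, ?_, hgf v, ?_, fun _ => Or.inl (by omega)⟩
      · have h1 : u ≤ g x := (hg _ _).1 (by rw [Fin.le_def]; omega)
        have h2 : ¬ v ≤ g x := fun h => by
          have := (hg _ _).2 h
          rw [Fin.le_def] at this
          omega
        rw [Fin.le_def] at h1 h2
        exact Fin.ext (by omega)
      · rw [Ne, Fin.ext_iff]
        omega
    · have e0 : g 0 = u := Fin.ext (by rw [hg0 0 rfl, h.1])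
      have ek : g (Fin.last k') = v := Fin.ext (by rw [hgk _ (Fin.val_last _), h.2])
      refine ⟨0, Fin.last k', e0, ek, ?_, fun _ => Or.inr (Or.inr (Or.inl ⟨rfl, rfl⟩))⟩
      intro e
      exact huv (by rw [← e0, ← ek, e])
  refine ⟨g, ⟨fun i => ⟨f i, hgf i⟩, fun x y hxy => ?_, fun x y hxy hne => ⟨hne, fun hc => ?_⟩,
    fun u v huv => ?_⟩, hgf⟩
  · exact (hconn' x).symm.trans (hxy ▸ hconn' y)
  · have hne' : (g x).val ≠ (g y).val := fun e => hne (Fin.ext e)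
    rcases hxy.2 hc with h | h | h | h
    · have h1 := hstep x y h
      have h2 : g x ≤ g y := hmono (by rw [Fin.le_def]; omega)
      rw [Fin.le_def] at h2
      omega
    · have h1 := hstep y x h
      have h2 : g y ≤ g x := hmono (by rw [Fin.le_def]; omega)
      rw [Fin.le_def] at h2
      omega
    · have := hg0 x h.1
      have := hgk y h.2
      omega
    · have := hgk x h.1
      have := hg0 y h.2
      omega
  · by_cases hc : cyc
    · have := huv.2 hc
      by_cases h : u.val + 1 = v ∨ (u.val = 0 ∧ v.val = k)
      · exact hlift u v hc h huv.1
      · obtain ⟨y, x, hy, hx, hxy⟩ := hlift v u hc (by omega) huv.1.symm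
        exact ⟨x, y, hx, hy, hxy.symm⟩
    · exact ⟨f u, f v, hgf u, hgf v, hf.injective.ne huv.1, fun h => (hc h).elim⟩

end SimpleGraph

/-! ### Connected sets attached to a core -/

namespace SimpleGraph

variable {V I : Type*} {G : SimpleGraph V}

/-- The edges of `G` that do not lie inside `K`. -/
def edgesOff (G : SimpleGraph V) (K : Set V) : SimpleGraph V where
  Adj x y := G.Adj x y ∧ ¬ (x ∈ K ∧ y ∈ K)
  symm := ⟨fun _ _ h => ⟨h.1.symm, fun h' => h.2 h'.symm⟩⟩
  loopless := ⟨fun _ h => G.loopless.irrefl _ h.1⟩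

/-- The edges of `G` that do not meet `K`. -/
def edgesAvoiding (G : SimpleGraph V) (K : Set V) : SimpleGraph V where
  Adj x y := G.Adj x y ∧ x ∉ K ∧ y ∉ K
  symm := ⟨fun _ _ h => ⟨h.1.symm, h.2.symm⟩⟩
  loopless := ⟨fun _ h => G.loopless.irrefl _ h.1⟩

theorem edgesOff_le (G : SimpleGraph V) (K : Set V) : G.edgesOff K ≤ G :=
  fun _ _ h => h.1

theorem connected_induce_reachable {H : SimpleGraph V} (hH : H ≤ G) (x : V) :
    (G.induce {y | H.Reachable x y}).Connected := by
  rw [connected_iff_exists_forall_reachable]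
  refine ⟨⟨x, .refl _⟩, fun ⟨y, hy⟩ => ?_⟩
  have key : ∃ h : H.Reachable x y, (G.induce {y | H.Reachable x y}).Reachable
      ⟨x, .refl _⟩ ⟨y, h⟩ := by
    refine Reachable.of_adj_closed (p := fun z => ∃ h : H.Reachable x z,
      (G.induce {y | H.Reachable x y}).Reachable ⟨x, .refl _⟩ ⟨z, h⟩) ?_ hy ⟨.refl _, .refl _⟩
    rintro a b hab ⟨ha, ha'⟩
    refine ⟨ha.trans hab.reachable, ha'.trans (Adj.reachable ?_)⟩
    exact hH hab
  exact key.2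

/-- A core no two vertices of which are joined off the core yields a decomposition. -/
theorem exists_isDecomposition [Nonempty I] {R : SimpleGraph I} (hG : G.Connected) {c : I → V}
    (hc : ∀ i j, R.Adj i j ↔ G.Adj (c i) (c j))
    (hsep : ∀ i j, (G.edgesOff (Set.range c)).Reachable (c i) (c j) → i = j) :
    ∃ π, IsDecomposition G R π c := by
  obtain ⟨i₀⟩ := ‹Nonempty I›
  -- Follow a walk from a core vertex, restarting at the far end of every edge that lies inside the
  -- core.
  have hex : ∀ x, ∃ i, (G.edgesOff (Set.range c)).Reachable (c i) x := by
    intro x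
    refine (hG (c i₀) x).of_adj_closed
      (p := fun x => ∃ i, (G.edgesOff (Set.range c)).Reachable (c i) x) ?_ ⟨i₀, .refl _⟩
    rintro a b hab ⟨i, hi⟩
    by_cases h : a ∈ Set.range c ∧ b ∈ Set.range c
    · obtain ⟨j, rfl⟩ := h.2
      exact ⟨j, .refl _⟩
    · exact ⟨i, hi.trans (Adj.reachable ⟨hab, h⟩)⟩
  choose π hπ using hex
  have hiff : ∀ x i, π x = i ↔ (G.edgesOff (Set.range c)).Reachable (c i) x := fun x i =>
    ⟨fun h => h ▸ hπ x, fun h => hsep _ _ ((hπ x).trans h.symm)⟩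
  refine ⟨π, fun i => (hiff _ _).2 (.refl _), fun i => ?_, hc, fun x y hxy hne => ?_⟩
  · rw [show {x | π x = i} = {x | (G.edgesOff (Set.range c)).Reachable (c i) x} from
      Set.ext fun x => hiff x i]
    exact connected_induce_reachable (G.edgesOff_le _) _
  · by_cases h : x ∈ Set.range c
    · obtain ⟨j, rfl⟩ := h
      rw [(hiff (c j) j).2 (.refl _)]
    · refine (hne ?_).elim
      rw [hiff]
      exact (hπ y).trans (Adj.reachable ⟨hxy.symm, fun h' => h h'.2⟩)

/-- If two core vertices are joined off the core, then they are joined by a connected set. -/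
theorem exists_connected_of_not_separated {c : I → V} {i j : I} (hinj : Function.Injective c)
    (hij : i ≠ j) (h : (G.edgesOff (Set.range c)).Reachable (c i) (c j)) :
    ∃ D : Set V, (G.induce D).Connected ∧ (∀ i, c i ∉ D) ∧
      ∃ i j, i ≠ j ∧ (∃ a ∈ D, G.Adj a (c i)) ∧ ∃ b ∈ D, G.Adj b (c j) := by
  by_contra! hcon
  let K := Set.range c
  have hle : G.edgesAvoiding K ≤ G := fun _ _ h => h.1
  -- Invariant along the walk: it is at `c i`, or in a component of the complement of the core that
  -- touches `c i`. Stepping to another core vertex would make that component the set `D` that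
  -- `hcon` excludes.
  have key : c j = c i ∨ (c j ∉ K ∧ ∃ w, (G.edgesAvoiding K).Reachable (c j) w ∧ G.Adj w (c i)) := by
    refine h.of_adj_closed (p := fun z => z = c i ∨
      (z ∉ K ∧ ∃ w, (G.edgesAvoiding K).Reachable z w ∧ G.Adj w (c i))) ?_ (Or.inl rfl)
    rintro a b hab (rfl | ⟨haK, w, haw, hw⟩)
    · have hb : b ∉ K := fun hb => hab.2 ⟨⟨i, rfl⟩, hb⟩
      exact Or.inr ⟨hb, b, .refl _, hab.1.symm⟩
    · by_cases hb : b ∈ K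
      · obtain ⟨l, rfl⟩ := hb
        left
        by_contra hne
        refine hcon {y | (G.edgesAvoiding K).Reachable a y} (connected_induce_reachable hle a) ?_
          i l (fun e => hne (e ▸ rfl)) ⟨w, haw, hw⟩ a (.refl _) hab.1
        intro m hm
        exact Reachable.of_adj_closed (G := G.edgesAvoiding K) (p := (· ∉ K))
          (fun _ _ h _ => h.2.2) hm haK ⟨m, rfl⟩
      · exact Or.inr ⟨hb, w, (Adj.reachable (G := G.edgesAvoiding K) ⟨hab.1.symm, hb, haK⟩).trans haw, hw⟩
  rcases key with h | h
  · exact hij (hinj h).symm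
  · exact h.1 ⟨j, rfl⟩

theorem exists_connected_diff_singleton {D : Set V} (hfin : D.Finite) (hD : (G.induce D).Connected)
    (hn : D.Nontrivial) : ∃ v ∈ D, (G.induce (D \ {v})).Connected := by
  have := hfin.to_subtype
  have := hn.coe_sort
  obtain ⟨v, hv⟩ := hD.exists_connected_induce_compl_singleton_of_finite_nontrivial
  refine ⟨v, v.2, ?_⟩
  refine hv.map ⟨fun x => ⟨x.1.1, x.1.2, fun e => x.2 (Subtype.ext e)⟩, fun h => h⟩ ?_
  rintro ⟨x, hx, hxv⟩
  exact ⟨⟨⟨x, hx⟩, fun e => hxv (congrArg Subtype.val e)⟩, rfl⟩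

/-- A connected set attached to two vertices of a maximal clique with at least three vertices
yields a diamond model. -/
theorem exists_isDiamondModel_of_clique [Finite V] {k : ℕ} (hk : 2 ≤ k) {c : Fin (k + 1) → V}
    (hc : ∀ i j, i ≠ j → G.Adj (c i) (c j)) (hmax : ∀ x, ∃ i, ¬ G.Adj x (c i))
    {D : Set V} (hD : (G.induce D).Connected) (hcD : ∀ i, c i ∉ D) {i j : Fin (k + 1)}
    (hij : i ≠ j) (hi : ∃ a ∈ D, G.Adj a (c i)) (hj : ∃ b ∈ D, G.Adj b (c j)) :
    ∃ A B C D, IsDiamondModel G A B C D := by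
  induction hn : D.ncard using Nat.strong_induction_on generalizing D i j with
  | _ n ih =>
    -- If `c l` has no neighbour in `D`, then `D` and `c l` are the nonadjacent parts, with `c i`
    -- and `c j` as the others. If all are touched, `D` is not a singleton by maximality, so a
    -- non-cut vertex `v` can be removed. Either the rest still touches two clique vertices, or `v`
    -- is adjacent to all but at most one of the at least three; both give a smaller set.
    by_cases hall : ∀ l, ∃ a ∈ D, G.Adj a (c l)
    · have hnt : D.Nontrivial := by
        by_contra hs
        rw [Set.not_nontrivial_iff] at hs
        obtain ⟨x, hx⟩ := exists_mem_of_connected_induce hD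
        obtain ⟨l, hl⟩ := hmax x
        obtain ⟨a, ha, hal⟩ := hall l
        rw [hs ha hx] at hal
        exact hl hal
      obtain ⟨v, hv, hconn⟩ := exists_connected_diff_singleton D.toFinite hD hnt
      by_cases h2 : ∃ l m, l ≠ m ∧ (∃ a ∈ D \ {v}, G.Adj a (c l)) ∧ ∃ a ∈ D \ {v}, G.Adj a (c m)
      · obtain ⟨l, m, hlm, hl, hm⟩ := h2
        refine ih _ ?_ hconn (fun i h => hcD i h.1) hlm hl hm rfl
        rw [← hn]
        exact Set.ncard_sdiff_singleton_lt_of_mem hv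
      · push Not at h2
        have hvall : ∃ l₀, ∀ l ≠ l₀, G.Adj v (c l) := by
          by_cases h1 : ∃ l, ∃ a ∈ D \ {v}, G.Adj a (c l)
          · obtain ⟨l₀, hl₀⟩ := h1
            refine ⟨l₀, fun l hl => ?_⟩
            obtain ⟨a, ha, hal⟩ := hall l
            by_cases hav : a = v
            · exact hav ▸ hal
            · exact (h2 l₀ l hl.symm hl₀ a ⟨ha, hav⟩ hal).elim
          · push Not at h1
            refine ⟨0, fun l _ => ?_⟩
            obtain ⟨a, ha, hal⟩ := hall l
            by_cases hav : a = v
            · exact hav ▸ hal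
            · exact (h1 l a ⟨ha, hav⟩ hal).elim
        obtain ⟨l₀, hl₀⟩ := hvall
        obtain ⟨l, m, hl, hm, hlm⟩ : ∃ l m : Fin (k + 1), l ≠ l₀ ∧ m ≠ l₀ ∧ l ≠ m := by
          have : 1 < (Finset.univ.erase l₀).card := by
            rw [Finset.card_erase_of_mem (Finset.mem_univ _), Finset.card_univ, Fintype.card_fin]
            omega
          obtain ⟨l, hl, m, hm, hlm⟩ := Finset.one_lt_card.1 this
          exact ⟨l, m, Finset.ne_of_mem_erase hl, Finset.ne_of_mem_erase hm, hlm⟩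
        refine ih _ ?_ (connected_induce_singleton v) (fun i h => hcD i (h ▸ hv)) hlm
          ⟨v, rfl, hl₀ l hl⟩ ⟨v, rfl, hl₀ m hm⟩ rfl
        rw [← hn, Set.ncard_singleton]
        exact Set.one_lt_ncard_iff_nontrivial.2 hnt
    · push Not at hall
      obtain ⟨l, hl⟩ := hall
      have hli : l ≠ i := by
        rintro rfl
        obtain ⟨a, ha, hai⟩ := hi
        exact hl a ha hai
      have hlj : l ≠ j := by
        rintro rfl
        obtain ⟨a, ha, hai⟩ := hj
        exact hl a ha hai
      have single : ∀ {x y : V}, G.Adj x y → ∃ a ∈ ({x} : Set V), ∃ b ∈ ({y} : Set V), G.Adj a b :=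
        fun h => ⟨_, rfl, _, rfl, h⟩
      obtain ⟨a, ha, hai⟩ := hi
      obtain ⟨b, hb, hbj⟩ := hj
      exact ⟨D, {c l}, {c i}, {c j}, hD, connected_induce_singleton _, connected_induce_singleton _,
        connected_induce_singleton _, Set.disjoint_singleton_right.2 (hcD _),
        Set.disjoint_singleton_right.2 (hcD _), Set.disjoint_singleton_right.2 (hcD _),
        Set.disjoint_singleton.2 (hc _ _ hli).ne, Set.disjoint_singleton.2 (hc _ _ hlj).ne,
        Set.disjoint_singleton.2 (hc _ _ hij).ne, ⟨a, ha, _, rfl, hai⟩, ⟨b, hb, _, rfl, hbj⟩,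
        single (hc _ _ hli), single (hc _ _ hlj), single (hc _ _ hij),
        by rintro a ha _ rfl; exact hl a ha⟩

section Cycle

variable {k : ℕ} {c : Fin (k + 1) → V}

theorem connected_image_Icc (hc : ∀ i j, (coreGraph True k).Adj i j ↔ G.Adj (c i) (c j)) {a : ℕ}
    {b : ℕ} (hab : a ≤ b) (hb : b ≤ k) :
    (G.induce (c '' {i | a ≤ i.val ∧ i.val ≤ b})).Connected := by
  induction b, hab using Nat.le_induction with
  | base =>
    have : {i : Fin (k + 1) | a ≤ i.val ∧ i.val ≤ a} = {⟨a, by omega⟩} := by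
      ext i
      simp only [Set.mem_ofPred_eq, Set.mem_singleton_iff, Fin.ext_iff]
      omega
    rw [this, Set.image_singleton]
    exact connected_induce_singleton _
  | succ b hab ih =>
    have : {i : Fin (k + 1) | a ≤ i.val ∧ i.val ≤ b + 1} =
        insert ⟨b + 1, by omega⟩ {i : Fin (k + 1) | a ≤ i.val ∧ i.val ≤ b} := by
      ext i
      simp only [Set.mem_ofPred_eq, Set.mem_insert_iff, Fin.ext_iff]
      omega
    rw [this, Set.image_insert_eq]
    refine connected_induce_insert (ih (by omega))
      ⟨⟨b, by omega⟩, ⟨hab, le_rfl⟩, rfl⟩ ((hc _ _).1 ⟨?_, fun _ => ?_⟩)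
    · simp
    · exact Or.inr (Or.inl rfl)

/-- The outside of an arc is again an arc, through the closing edge if both sides are nonempty; `h`
excludes the case where it is empty. -/
theorem connected_image_outside (hc : ∀ i j, (coreGraph True k).Adj i j ↔ G.Adj (c i) (c j))
    {i j : Fin (k + 1)} (hij : i < j) (h : ¬ (i.val = 0 ∧ j.val = k)) :
    (G.induce (c '' {l | l < i ∨ j < l})).Connected := by
  have hij' : i.val < j.val := hij
  by_cases hi : i.val = 0
  · rw [show {l | l < i ∨ j < l} = {i : Fin (k + 1) | j.val + 1 ≤ i.val ∧ i.val ≤ k} by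
      ext l
      simp only [Set.mem_ofPred_eq, Fin.lt_def]
      omega]
    exact connected_image_Icc hc (by omega) (by omega)
  by_cases hj : j.val = k
  · rw [show {l | l < i ∨ j < l} = {l : Fin (k + 1) | 0 ≤ l.val ∧ l.val ≤ i.val - 1} by
      ext l
      simp only [Set.mem_ofPred_eq, Fin.lt_def]
      omega]
    exact connected_image_Icc hc (by omega) (by omega)
  have := connected_induce_union'
    (connected_image_Icc hc (a := 0) (b := i.val - 1) (by omega) (by omega))
    (connected_image_Icc hc (a := j.val + 1) (b := k) (by omega) le_rfl)
    ⟨c 0, ⟨0, ⟨le_rfl, by simp⟩, rfl⟩, c (Fin.last k), ⟨_, ⟨by rw [Fin.val_last]; omega,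
      by rw [Fin.val_last]⟩, rfl⟩, (hc _ _).1 ⟨fun e => ?_, fun _ => ?_⟩⟩
  · rw [← Set.image_union] at this
    rwa [show {l : Fin (k + 1) | 0 ≤ l.val ∧ l.val ≤ i.val - 1} ∪
        {l : Fin (k + 1) | j.val + 1 ≤ l.val ∧ l.val ≤ k} = {l | l < i ∨ j < l} by
      ext l
      simp only [Set.mem_ofPred_eq, Fin.lt_def, Set.mem_union]
      omega] at this
  · rw [Fin.ext_iff, Fin.val_last, Fin.val_zero] at e
    omega
  · exact Or.inr (Or.inr (Or.inl ⟨rfl, rfl⟩))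

/-- A connected set attached to two vertices of an induced cycle of length at least four yields a
diamond model. -/
theorem exists_isDiamondModel_of_cycle (hk : 3 ≤ k) (hinj : Function.Injective c)
    (hc : ∀ i j, (coreGraph True k).Adj i j ↔ G.Adj (c i) (c j))
    {D : Set V} (hD : (G.induce D).Connected) (hcD : ∀ i, c i ∉ D) {i j : Fin (k + 1)}
    (hij : i ≠ j) (hi : ∃ a ∈ D, G.Adj a (c i)) (hj : ∃ b ∈ D, G.Adj b (c j)) :
    ∃ A B C D, IsDiamondModel G A B C D := by
  have adj_iff : ∀ i j : Fin (k + 1), G.Adj (c i) (c j) ↔ i.val + 1 = j ∨ j.val + 1 = i ∨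
      (i.val = 0 ∧ j.val = k) ∨ (i.val = k ∧ j.val = 0) := by
    intro i j
    rw [← hc]
    refine ⟨fun h => h.2 trivial, fun h => ⟨?_, fun _ => h⟩⟩
    rintro rfl
    omega
  have image_disj : ∀ {S T : Set (Fin (k + 1))}, Disjoint S T → Disjoint (c '' S) (c '' T) :=
    fun h => Set.disjoint_image_of_injective hinj h
  have D_disj : ∀ S : Set (Fin (k + 1)), Disjoint D (c '' S) := fun S => by
    rw [Set.disjoint_right]
    rintro _ ⟨l, -, rfl⟩
    exact hcD l
  have adjI : ∀ {S T : Set (Fin (k + 1))} (a b : Fin (k + 1)), a ∈ S → b ∈ T → G.Adj (c a) (c b) →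
      ∃ x ∈ c '' S, ∃ y ∈ c '' T, G.Adj x y :=
    fun a b ha hb h => ⟨c a, ⟨a, ha, rfl⟩, c b, ⟨b, hb, rfl⟩, h⟩
  have inside_adj : ∀ i j : Fin (k + 1), i.val + 1 < j →
      (∃ x ∈ c '' {l | i.val + 1 ≤ l.val ∧ l.val ≤ j.val - 1}, ∃ y ∈ c '' {i}, G.Adj x y) ∧
      (∃ x ∈ c '' {l | i.val + 1 ≤ l.val ∧ l.val ≤ j.val - 1}, ∃ y ∈ c '' {j}, G.Adj x y) := by
    intro i j h
    refine ⟨adjI ⟨i.val + 1, by omega⟩ i ⟨le_rfl, Nat.le_sub_one_of_lt h⟩ rfl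
        ((adj_iff _ _).2 (Or.inr (Or.inl rfl))),
      adjI ⟨j.val - 1, by omega⟩ j ⟨Nat.le_sub_one_of_lt h, le_rfl⟩ rfl
        ((adj_iff _ _).2 (Or.inl ?_))⟩
    exact Nat.sub_add_cancel (by omega)
  have outside_adj : ∀ i j : Fin (k + 1), i < j → ¬ (i.val = 0 ∧ j.val = k) →
      (∃ x ∈ c '' {l | l < i ∨ j < l}, ∃ y ∈ c '' {i}, G.Adj x y) ∧
      (∃ x ∈ c '' {l | l < i ∨ j < l}, ∃ y ∈ c '' {j}, G.Adj x y) := by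
    intro i j hij h
    have hij' : i.val < j.val := hij
    constructor
    · by_cases hi : i.val = 0
      · refine adjI (Fin.last k) i (Or.inr ?_) rfl ((adj_iff _ _).2 ?_)
        · rw [Fin.lt_def, Fin.val_last]; omega
        · rw [Fin.val_last]; omega
      · refine adjI ⟨i.val - 1, by omega⟩ i (Or.inl ?_) rfl ((adj_iff _ _).2 (Or.inl ?_))
        · rw [Fin.lt_def]; exact Nat.sub_one_lt hi
        · exact Nat.sub_add_cancel (by omega)
    · by_cases hj : j.val = k
      · refine adjI 0 j (Or.inl ?_) rfl ((adj_iff _ _).2 ?_)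
        · rw [Fin.lt_def, Fin.val_zero]; omega
        · rw [Fin.val_zero]; omega
      · refine adjI ⟨j.val + 1, by omega⟩ j (Or.inr ?_) rfl ((adj_iff _ _).2 (Or.inr (Or.inl rfl)))
        rw [Fin.lt_def]; exact Nat.lt_succ_self _
  -- If `D` touches two nonconsecutive cycle vertices `c i` and `c j`, the two open arcs between
  -- them are the nonadjacent parts, and `D ∪ {c i}` and `{c j}` are the other two.
  by_cases hnc : ∃ i j : Fin (k + 1), i.val + 1 < j ∧ ¬ (i.val = 0 ∧ j.val = k) ∧
      (∃ a ∈ D, G.Adj a (c i)) ∧ ∃ b ∈ D, G.Adj b (c j)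
  · obtain ⟨i, j, hij, h, hi, b, hb, hbj⟩ := hnc
    have hlt : i < j := by rw [Fin.lt_def]; omega
    have hin := inside_adj i j hij
    have hout := outside_adj i j hlt h
    refine ⟨c '' {l | i.val + 1 ≤ l.val ∧ l.val ≤ j.val - 1}, c '' {l | l < i ∨ j < l},
      D ∪ c '' {i}, c '' {j}, connected_image_Icc hc (by omega) (by omega),
      connected_image_outside hc hlt h, connected_induce_union' hD
        (by rw [Set.image_singleton]; exact connected_induce_singleton _)
        (let ⟨a, ha, hai⟩ := hi; ⟨a, ha, c i, ⟨i, rfl, rfl⟩, hai⟩),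
      by rw [Set.image_singleton]; exact connected_induce_singleton _,
      image_disj ?_, Set.disjoint_union_right.2 ⟨(D_disj _).symm, image_disj ?_⟩, image_disj ?_,
      Set.disjoint_union_right.2 ⟨(D_disj _).symm, image_disj ?_⟩, image_disj ?_,
      Set.disjoint_union_left.2 ⟨D_disj _, image_disj ?_⟩,
      exists_adj_mono hin.1 subset_rfl Set.subset_union_right, hin.2,
      exists_adj_mono hout.1 subset_rfl Set.subset_union_right, hout.2,
      ⟨b, Or.inl hb, c j, ⟨j, rfl, rfl⟩, hbj⟩, ?_⟩
    · rw [Set.disjoint_left]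
      simp only [Set.mem_ofPred_eq, Fin.lt_def]
      omega
    · rw [Set.disjoint_singleton_right, Set.mem_ofPred_eq]
      omega
    · rw [Set.disjoint_singleton_right, Set.mem_ofPred_eq]
      omega
    · rw [Set.disjoint_singleton_right, Set.mem_ofPred_eq, Fin.lt_def, Fin.lt_def]
      omega
    · rw [Set.disjoint_singleton_right, Set.mem_ofPred_eq, Fin.lt_def, Fin.lt_def]
      omega
    · rw [Set.disjoint_singleton]
      exact hlt.ne
    · rintro _ ⟨a, ha, rfl⟩ _ ⟨b, hb, rfl⟩
      rw [adj_iff]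
      simp only [Set.mem_ofPred_eq, Fin.lt_def] at ha hb
      omega
  push Not at hnc
  have hnc' : ∀ i j : Fin (k + 1), i.val + 1 < j.val → (∃ a ∈ D, G.Adj a (c i)) →
      (∃ b ∈ D, G.Adj b (c j)) → i.val = 0 ∧ j.val = k := by
    rintro i j h hi ⟨b, hb, hbj⟩
    by_contra h'
    exact hnc i j h (fun h0 => by omega) hi b hb hbj
  -- Now all vertices touched by `D` are pairwise consecutive. As the cycle has at least four
  -- vertices, only `c i` and `c j` are touched, so `D` and the remaining arc are the nonadjacent
  -- parts.
  have hmodel : ∀ S : Set (Fin (k + 1)), (G.induce (c '' S)).Connected → i ∉ S → j ∉ S →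
      (∃ x ∈ c '' S, ∃ y ∈ c '' {i}, G.Adj x y) → (∃ x ∈ c '' S, ∃ y ∈ c '' {j}, G.Adj x y) →
      G.Adj (c i) (c j) → (∀ l ∈ S, ¬ ∃ a ∈ D, G.Adj a (c l)) →
      IsDiamondModel G D (c '' S) (c '' {i}) (c '' {j}) := by
    intro S hS hiS hjS hSi hSj hadj hSD
    refine ⟨hD, hS, by rw [Set.image_singleton]; exact connected_induce_singleton _,
      by rw [Set.image_singleton]; exact connected_induce_singleton _, D_disj _, D_disj _, D_disj _,
      image_disj (Set.disjoint_singleton_right.2 hiS),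
      image_disj (Set.disjoint_singleton_right.2 hjS), image_disj (Set.disjoint_singleton.2 hij),
      let ⟨a, ha, hai⟩ := hi; ⟨a, ha, c i, ⟨i, rfl, rfl⟩, hai⟩,
      let ⟨a, ha, hai⟩ := hj; ⟨a, ha, c j, ⟨j, rfl, rfl⟩, hai⟩, hSi, hSj,
      adjI i j rfl rfl hadj, ?_⟩
    rintro a ha _ ⟨l, hl, rfl⟩ hal
    exact hSD l hl ⟨a, ha, hal⟩
  wlog hlt : i < j generalizing i j
  · exact this hij.symm hj hi (fun S h1 h2 h3 h4 h5 h6 h7 =>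
      (hmodel S h1 h3 h2 h5 h4 h6.symm h7).swapCD)
      (lt_of_le_of_ne (not_lt.1 hlt) hij.symm)
  have hlt' : i.val < j.val := hlt
  by_cases hcons : i.val + 1 = j.val
  · have hend : ¬ (i.val = 0 ∧ j.val = k) := by omega
    have hout := outside_adj i j hlt hend
    refine ⟨_, _, _, _, hmodel _ (connected_image_outside hc hlt hend) ?_ ?_ hout.1 hout.2
      ((adj_iff _ _).2 (Or.inl hcons)) ?_⟩
    · simp [hlt.not_gt]
    · simp [hlt.not_gt]
    · rintro l hl hlD
      simp only [Set.mem_ofPred_eq, Fin.lt_def] at hl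
      have h1 := fun h => hnc' l j h hlD hj
      have h2 := fun h => hnc' l i h hlD hi
      have h3 := fun h => hnc' i l h hi hlD
      have h4 := fun h => hnc' j l h hj hlD
      omega
  · have hend := hnc' i j (by omega) hi hj
    have hin := inside_adj i j (by omega)
    refine ⟨_, _, _, _, hmodel _ (connected_image_Icc hc (by omega) (by omega)) ?_ ?_ hin.1 hin.2
      ((adj_iff _ _).2 (Or.inr (Or.inr (Or.inl hend)))) ?_⟩
    · simp
    · simp only [Set.mem_ofPred_eq]
      omega
    · rintro l hl hlD
      simp only [Set.mem_ofPred_eq] at hl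
      have h1 := fun h => hnc' l j h hlD hj
      have h3 := fun h => hnc' i l h hi hlD
      omega

end Cycle

end SimpleGraph

/-! ### Existence of a clique or cycle core through a given vertex -/

namespace SimpleGraph

variable {V : Type*} {G : SimpleGraph V}

/-- A shortest path, as an injective sequence of vertices. -/
theorem Reachable.exists_geodesic {u v : V} (h : G.Reachable u v) :
    ∃ (k : ℕ) (c : Fin (k + 1) → V), c 0 = u ∧ c (Fin.last k) = v ∧ Function.Injective c ∧
      ∀ i j, G.Adj (c i) (c j) ↔ i.val + 1 = j ∨ j.val + 1 = i := by
  obtain ⟨p, hp⟩ := h.exists_walk_length_eq_dist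
  have hinj : ∀ i j : ℕ, i < j → j ≤ p.length → p.getVert i ≠ p.getVert j := by
    intro i j hij hj e
    have := dist_le ((p.take i).append ((p.drop j).copy e.symm rfl))
    rw [Walk.length_append, Walk.length_copy, Walk.take_length, Walk.drop_length] at this
    omega
  have hadj : ∀ i j : ℕ, i < j → j ≤ p.length → G.Adj (p.getVert i) (p.getVert j) → i + 1 = j := by
    intro i j hij hj e
    have := dist_le ((p.take i).append (.cons e (p.drop j)))
    rw [Walk.length_append, Walk.length_cons, Walk.take_length, Walk.drop_length] at this
    omega
  refine ⟨p.length, fun i => p.getVert i, by simp, by simp, fun i j hij => ?_, fun i j => ?_⟩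
  · rcases lt_trichotomy i.val j.val with h | h | h
    · exact (hinj i j h (by omega) hij).elim
    · exact Fin.ext h
    · exact (hinj j i h (by omega) hij.symm).elim
  · change G.Adj (p.getVert i) (p.getVert j) ↔ _
    constructor
    · intro h
      rcases lt_trichotomy i.val j.val with h' | h' | h'
      · exact Or.inl (hadj i j h' (by omega) h)
      · exact (h.ne (congrArg p.getVert h')).elim
      · exact Or.inr (hadj j i h' (by omega) h.symm)
    · rintro (h | h)
      · rw [← h]
        exact p.adj_getVert_succ (by omega)
      · rw [← h]
        exact (p.adj_getVert_succ (by omega)).symm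

/-- A triangle extends to a maximal clique. -/
theorem exists_maximal_clique [Finite V] {r s t : V} (hrs : G.Adj r s) (hrt : G.Adj r t)
    (hst : G.Adj s t) : ∃ k, 2 ≤ k ∧ ∃ c : Fin (k + 1) → V, c 0 = r ∧
      (∀ i j, i ≠ j → G.Adj (c i) (c j)) ∧ ∀ x, ∃ i, ¬ G.Adj x (c i) := by
  classical
  let P : ℕ → Prop := fun k => ∃ c : Fin (k + 1) → V, c 0 = r ∧ ∀ i j, i ≠ j → G.Adj (c i) (c j)
  have hP2 : P 2 := by
    refine ⟨![r, s, t], rfl, fun i j hij => ?_⟩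
    fin_cases i <;> fin_cases j <;> simp_all [G.adj_comm]
  have hbound : ∀ k, P k → k ≤ Nat.card V := by
    rintro k ⟨c, -, hc⟩
    have := Nat.card_le_card_of_injective c fun i j hij => by
      by_contra hne
      exact (hc i j hne).ne hij
    rw [Nat.card_fin] at this
    omega
  have hspec : P (Nat.findGreatest P (Nat.card V)) :=
    Nat.findGreatest_spec (hbound 2 hP2) hP2
  have hmax : ∀ m, P m → m ≤ Nat.findGreatest P (Nat.card V) := fun m hm =>
    Nat.le_findGreatest (hbound m hm) hm
  generalize Nat.findGreatest P (Nat.card V) = k at hspec hmax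
  obtain ⟨c, hc0, hc⟩ := hspec
  refine ⟨k, hmax 2 hP2, c, hc0, hc, fun x => ?_⟩
  by_contra! hx
  have := hmax (k + 1) ⟨Fin.snoc c x, ?_, ?_⟩
  · omega
  · rw [← hc0]
    exact Fin.snoc_castSucc (α := fun _ => V) x c 0
  · intro i j hij
    induction i using Fin.lastCases with
    | last =>
      induction j using Fin.lastCases with
      | last => exact (hij rfl).elim
      | cast j => simpa using hx j
    | cast i =>
      induction j using Fin.lastCases with
      | last => simpa using (hx i).symm
      | cast j =>
        simpa using hc i j fun e => hij (by rw [e])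

/-- A connected graph without diamond models consists of smaller graphs attached to the vertices
of a clique or of a cycle through a prescribed vertex. -/
theorem exists_isDecomposition_coreGraph [Finite V] [Nontrivial V] (hG : G.Connected)
    (hdia : ∀ A B C D, ¬ IsDiamondModel G A B C D) (r : V) :
    ∃ (cyc : Prop) (k : ℕ) (π : V → Fin (k + 1)) (c : Fin (k + 1) → V),
      1 ≤ k ∧ c 0 = r ∧ IsDecomposition G (coreGraph cyc k) π c := by
  have core_false : ∀ {k : ℕ} {c : Fin (k + 1) → V}, (∀ i j, i ≠ j → G.Adj (c i) (c j)) →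
      ∀ i j, (coreGraph False k).Adj i j ↔ G.Adj (c i) (c j) := fun hc i j =>
    ⟨fun h => hc i j h.1, fun h => ⟨fun e => h.ne (congrArg _ e), False.elim⟩⟩
  obtain ⟨s, hrs⟩ := hG.preconnected.exists_adj_of_nontrivial r
  -- If `rs` is not a bridge, a geodesic from `r` to `s` avoiding it closes up to an induced cycle
  -- on `k + 1` vertices; `k = 2` is the triangle case. A bridge is itself the core.
  by_cases hbr : (G.deleteEdges {s(r, s)}).Reachable r s
  · obtain ⟨k, c, hc0, hck, hinj, hc⟩ := hbr.exists_geodesic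
    have hk0 : k ≠ 0 := by
      rintro rfl
      exact hrs.ne (hc0.symm.trans hck)
    have hk1 : k ≠ 1 := by
      rintro rfl
      have := (hc 0 (Fin.last 1)).2 (Or.inl rfl)
      rw [hc0, hck] at this
      simp at this
    by_cases hk2 : k = 2
    · subst hk2
      have h01 := (hc 0 1).2 (Or.inl rfl)
      have h12 := (hc 1 (Fin.last 2)).2 (Or.inl rfl)
      rw [hc0] at h01
      rw [hck] at h12
      obtain ⟨k, hk, c, hc0, hc, hmax⟩ := exists_maximal_clique h01.1 hrs h12.1
      obtain ⟨π, hπ⟩ := exists_isDecomposition hG (core_false hc) fun i j hij => by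
        by_contra hne
        obtain ⟨D, hD, hcD, i, j, hij, hi, hj⟩ := exists_connected_of_not_separated
          (fun i j h => by_contra fun hne => (hc i j hne).ne h) hne hij
        obtain ⟨A, B, C, D, h⟩ := exists_isDiamondModel_of_clique hk hc hmax hD hcD hij hi hj
        exact hdia A B C D h
      exact ⟨False, k, π, c, by omega, hc0, hπ⟩
    · have hcore : ∀ i j, (coreGraph True k).Adj i j ↔ G.Adj (c i) (c j) := by
        intro i j
        have h0 : ∀ i : Fin (k + 1), i.val = 0 ↔ c i = r := fun i => by
          rw [← hc0, hinj.eq_iff, Fin.ext_iff, Fin.val_zero]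
        have hk : ∀ i : Fin (k + 1), i.val = k ↔ c i = s := fun i => by
          rw [← hck, hinj.eq_iff, Fin.ext_iff, Fin.val_last]
        have h1 := hc i j
        rw [deleteEdges_adj, Set.mem_singleton_iff, Sym2.eq_iff, ← h0, ← hk, ← h0, ← hk] at h1
        have h2 : (i.val = 0 ∧ j.val = k) → G.Adj (c i) (c j) := fun ⟨hi, hj⟩ => by
          rwa [(h0 i).1 hi, (hk j).1 hj]
        have h3 : (i.val = k ∧ j.val = 0) → G.Adj (c i) (c j) := fun ⟨hi, hj⟩ => by
          rw [(hk i).1 hi, (h0 j).1 hj]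
          exact hrs.symm
        constructor
        · rintro ⟨-, h⟩
          rcases h trivial with h | h | h | h
          · exact (h1.2 (Or.inl h)).1
          · exact (h1.2 (Or.inr h)).1
          · exact h2 h
          · exact h3 h
        · intro h
          refine ⟨fun e => h.ne (congrArg c e), fun _ => ?_⟩
          tauto
      obtain ⟨π, hπ⟩ := exists_isDecomposition hG hcore fun i j hij => by
        by_contra hne
        obtain ⟨D, hD, hcD, i, j, hij, hi, hj⟩ := exists_connected_of_not_separated hinj hne hij
        obtain ⟨A, B, C, D, h⟩ :=
          exists_isDiamondModel_of_cycle (by omega) hinj hcore hD hcD hij hi hj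
        exact hdia A B C D h
      exact ⟨True, k, π, c, by omega, hc0, hπ⟩
  · have hc : ∀ i j, i ≠ j → G.Adj (![r, s] i) (![r, s] j) := by
      intro i j hij
      fin_cases i <;> fin_cases j <;> simp_all [G.adj_comm]
    have hle : G.edgesOff (Set.range ![r, s]) ≤ G.deleteEdges {s(r, s)} := by
      intro x y hxy
      refine deleteEdges_adj.2 ⟨hxy.1, fun e => hxy.2 ?_⟩
      rcases Sym2.eq_iff.1 e with ⟨rfl, rfl⟩ | ⟨rfl, rfl⟩ <;> simp
    obtain ⟨π, hπ⟩ := exists_isDecomposition hG (core_false hc) fun i j hij => by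
      have := hij.mono hle
      fin_cases i <;> fin_cases j
      · rfl
      · exact (hbr this).elim
      · exact (hbr this.symm).elim
      · rfl
    exact ⟨False, 1, π, ![r, s], le_rfl, rfl, hπ⟩

end SimpleGraph

/-! ### Rooted graphs and the minimal bad sequence -/

open SimpleGraph

/-- Turns the relation in Higman's lemma into an increasing map of indices, as needed to contract
one core onto another. -/
theorem List.SublistForall₂.exists_strictMono {α : Type*} {r : α → α → Prop} {m n : ℕ}
    {a : Fin m → α} {b : Fin n → α} (h : List.SublistForall₂ r (List.ofFn a) (List.ofFn b)) :
    ∃ f : Fin m → Fin n, StrictMono f ∧ ∀ i, r (a i) (b (f i)) := by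
  obtain ⟨l, hl, hsub⟩ := List.sublistForall₂_iff.1 h
  obtain ⟨e, he⟩ := List.sublist_iff_exists_fin_orderEmbedding_get_eq.1 hsub
  have hlen := hl.length_eq
  rw [List.length_ofFn] at hlen
  refine ⟨fun i => Fin.cast List.length_ofFn (e (Fin.cast hlen i)), fun i j hij => ?_, fun i => ?_⟩
  · have : e (Fin.cast hlen i) < e (Fin.cast hlen j) := e.strictMono hij
    exact this
  · have h1 := List.Forall₂.get hl (i := i.val) (by simp) (by omega)
    have h2 := he (Fin.cast hlen i)
    simp only [List.get_eq_getElem, List.getElem_ofFn, Fin.val_cast] at h1 h2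
    rw [h2] at h1
    exact h1

/-- A finite graph with a distinguished vertex. -/
structure RootedGraph where
  V : Type
  [finite : Finite V]
  graph : SimpleGraph V
  root : V

namespace RootedGraph

attribute [instance] RootedGraph.finite

/-- Contraction of rooted graphs. -/
def IsContraction (A B : RootedGraph) : Prop :=
  ∃ φ : B.V → A.V, IsContractionMap B.graph A.graph φ ∧ φ B.root = A.root

instance : IsPreorder RootedGraph IsContraction where
  refl _ := ⟨id, .of_iso Iso.refl, rfl⟩
  trans _ _ _ := fun ⟨φ, hφ, e⟩ ⟨ψ, hψ, e'⟩ => ⟨φ ∘ ψ, hφ.comp hψ, by simp [e, e']⟩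

/-- The connected rooted graphs that are diamond-contraction-free. -/
def diamondFree : Set RootedGraph :=
  {A | A.graph.Connected ∧ ¬ FinGraph.IsContraction FinGraph.diamond ⟨A.V, A.graph⟩}

theorem mem_diamondFree_of_map {A : RootedGraph} (hA : A ∈ diamondFree) {W : Type} [Finite W]
    {H : SimpleGraph W} {φ : A.V → W} (hφ : IsContractionMap A.graph H φ) (w : W) :
    (⟨W, H, w⟩ : RootedGraph) ∈ diamondFree :=
  ⟨hφ.connected hA.1, fun h => hA.2 (Relation.ReflTransGen.trans
    (FinGraph.isContraction_iff (H := ⟨W, H⟩) (G := ⟨A.V, A.graph⟩).2 ⟨φ, hφ⟩) h)⟩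

/-- `A` consists of the rooted graphs `L i` attached to the vertices of a clique or cycle. -/
def IsAssembly (A : RootedGraph) (cyc : Prop) (k : ℕ) (L : Fin (k + 1) → RootedGraph) : Prop :=
  ∃ (π : A.V → Fin (k + 1)) (c : Fin (k + 1) → A.V)
    (h : IsDecomposition A.graph (coreGraph cyc k) π c), c 0 = A.root ∧
      ∀ i, L i = ⟨{x | π x = i}, A.graph.induce _, ⟨c i, h.map_core i⟩⟩

/-- The retraction of `f` contracts the cores and `hL` the selected pieces. Since `f 0 = 0`, root
goes to root. -/
theorem IsAssembly.isContraction {A A' : RootedGraph} {cyc : Prop} {k k' : ℕ}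
    {L : Fin (k + 1) → RootedGraph} {L' : Fin (k' + 1) → RootedGraph} (h : A.IsAssembly cyc k L)
    (h' : A'.IsAssembly cyc k' L') {f : Fin (k + 1) → Fin (k' + 1)} (hf : StrictMono f)
    (hf0 : f 0 = 0) (hL : ∀ i, (L i).IsContraction (L' (f i))) : A.IsContraction A' := by
  obtain ⟨π, c, h, hc0, hLi⟩ := h
  obtain ⟨π', c', h', hc0', hLi'⟩ := h'
  obtain ⟨g, hg, hgf⟩ := exists_isContractionMap_coreGraph cyc hf hf0
  obtain ⟨Φ, hΦ, hΦc⟩ := h.exists_map h' hg hgf fun i => by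
    have := hL i
    rw [hLi, hLi'] at this
    exact this
  refine ⟨Φ, hΦ, ?_⟩
  rw [← hc0, ← hc0', hΦc, ← hf0, hgf]

/-- A piece is smaller because the core has another vertex outside it, and it is a rooted
contraction of `A` by collapsing everything else onto its core vertex. The minimal bad sequence
argument needs both facts. -/
theorem exists_isAssembly {A : RootedGraph} (hA : A ∈ diamondFree) [Nontrivial A.V] :
    ∃ cyc k L, A.IsAssembly cyc k L ∧
      ∀ i, L i ∈ diamondFree ∧ Nat.card (L i).V < Nat.card A.V ∧ (L i).IsContraction A := by
  obtain ⟨cyc, k, π, c, hk, hc0, h⟩ := exists_isDecomposition_coreGraph hA.1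
    (fun A B C D hdia => hA.2 (FinGraph.isContraction_diamond_of_model hA.1 hdia)) A.root
  refine ⟨cyc, k, _, ⟨π, c, h, hc0, fun i => rfl⟩, fun i => ?_⟩
  obtain ⟨Φ, hΦ, hΦc⟩ := h.exists_map_part hA.1 i
  refine ⟨mem_diamondFree_of_map hA hΦ _, ?_, Φ, hΦ, ?_⟩
  · obtain ⟨j, hj⟩ : ∃ j : Fin (k + 1), j ≠ i := by
      have : Nontrivial (Fin (k + 1)) := Fin.nontrivial_iff_two_le.2 (by omega)
      exact exists_ne i
    refine Finite.card_subtype_lt (x := c j) ?_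
    change ¬ π (c j) = i
    rwa [h.map_core]
  · rw [← hc0]
    exact hΦc 0

theorem diamondFree_partiallyWellOrderedOn :
    diamondFree.PartiallyWellOrderedOn IsContraction := by
  rw [Set.PartiallyWellOrderedOn.iff_not_exists_isMinBadSeq fun A => Nat.card A.V]
  rintro ⟨F, ⟨hF, hbad⟩, hmin⟩
  -- A one-vertex graph is a contraction of every connected graph, so it cannot occur in a bad
  -- sequence.
  have hnt : ∀ n, Nontrivial (F n).V := by
    intro n
    by_contra hs
    rw [not_nontrivial_iff_subsingleton] at hs
    have : Nonempty (F n).V := ⟨(F n).root⟩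
    exact hbad n (n + 1) n.lt_succ_self
      ⟨fun _ => (F n).root, .of_subsingleton (hF (n + 1)).1 _, rfl⟩
  choose cyc k L hL hL' using fun n => exists_isAssembly (hF n)
  have hT : {B | ∃ n i, B = L n i}.PartiallyWellOrderedOn IsContraction := by
    rw [Set.PartiallyWellOrderedOn.iff_forall_not_isBadSeq]
    rintro t ⟨ht, htbad⟩
    choose N i hN using ht
    obtain ⟨j₀, hj₀⟩ : ∃ j₀, ∀ j, N j₀ ≤ N j :=
      ⟨Function.argmin N, fun j => Function.argmin_le N j⟩
    -- Splice a bad sequence of pieces, from its term of least origin `N j₀` on, after the first `N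
    -- j₀` terms of `F`. The result is bad, since a piece is a contraction of the graph it comes
    -- from, and it contradicts minimality at `N j₀`.
    refine hmin (N j₀) (fun m => if m < N j₀ then F m else t (j₀ + (m - N j₀)))
      (fun m hm => (if_pos hm).symm) ?_ ⟨fun m => ?_, fun m n hmn hle => ?_⟩
    · simp only [lt_irrefl, if_false, Nat.sub_self, Nat.add_zero]
      rw [hN j₀]
      exact (hL' _ _).2.1
    · dsimp only
      split_ifs
      · exact hF m
      · rw [hN]
        exact (hL' _ _).1
    · dsimp only at hle
      by_cases hm : m < N j₀
      · rw [if_pos hm] at hle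
        by_cases hn : n < N j₀
        · rw [if_pos hn] at hle
          exact hbad m n hmn hle
        · rw [if_neg hn, hN] at hle
          exact hbad m _ (hm.trans_le (hj₀ _)) (_root_.trans hle (hL' _ _).2.2)
      · rw [if_neg hm, if_neg (by omega)] at hle
        exact htbad _ _ (by omega) hle
  have hlist := Set.PartiallyWellOrderedOn.partiallyWellOrderedOn_sublistForall₂ _ hT
  -- Compare the type of the core, the piece at the root, and the list of the other pieces. Keeping
  -- the root piece apart forces index `0` to go to `0`.
  have hprod := ((Set.finite_univ (α := Prop)).partiallyWellOrderedOn (r := Eq)).prod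
    (hT.prod hlist)
  obtain ⟨m, n, hmn, h1, h2, h3⟩ := hprod.exists_lt
    (f := fun n => (cyc n, L n 0, List.ofFn fun i : Fin (k n) => L n i.succ)) fun n => by
      refine ⟨trivial, ⟨n, 0, rfl⟩, fun x hx => ?_⟩
      obtain ⟨i, rfl⟩ := (List.mem_ofFn' _ _).1 hx
      exact ⟨n, i.succ, rfl⟩
  obtain ⟨f, hf, hfL⟩ := h3.exists_strictMono
  have hm := hL m
  rw [show cyc m = cyc n from h1] at hm
  refine hbad m n hmn (hm.isContraction (hL n) (f := Fin.cons 0 fun i => (f i).succ) ?_ rfl ?_)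
  · intro i j hij
    induction i using Fin.cases with
    | zero =>
      induction j using Fin.cases with
      | zero => exact (lt_irrefl _ hij).elim
      | succ j => simp
    | succ i =>
      induction j using Fin.cases with
      | zero => exact (Fin.not_lt_zero _ hij).elim
      | succ j => simpa using hf (Fin.succ_lt_succ_iff.1 hij)
  · intro i
    induction i using Fin.cases with
    | zero => exact h2
    | succ i => simpa using hfL i

end RootedGraph

namespace FinGraph

theorem wellQuasiOrderedLE_diamond : WellQuasiOrderedLE (connectedContractionFree diamond) := by
  refine ⟨fun F => ?_⟩
  have hr : ∀ n, Nonempty (F n).1.V := fun n => (F n).2.1.nonempty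
  obtain ⟨m, n, hmn, φ, hφ, -⟩ := RootedGraph.diamondFree_partiallyWellOrderedOn.exists_lt
    (f := fun n => ⟨(F n).1.V, (F n).1.graph, (hr n).some⟩) fun n => (F n).2
  exact ⟨m, n, hmn, isContraction_iff.2 ⟨φ, hφ⟩⟩

theorem wellQuasiOrderedLE_of_isContraction_diamond {H : FinGraph} (h : IsContraction H diamond) :
    WellQuasiOrderedLE (connectedContractionFree H) := by
  refine ⟨fun F => ?_⟩
  exact wellQuasiOrderedLE_diamond.wqo fun n =>
    ⟨(F n).1, (F n).2.1, fun hd => (F n).2.2 (Relation.ReflTransGen.trans hd h)⟩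

end FinGraph

/-! ### Necessity: complete bipartite graphs and complements of cycles -/

namespace FinGraph

open SimpleGraph

/-- If `connectedContractionFree H` is well-quasi-ordered, then `H` is a contraction of a member
of each sequence of connected graphs none of which is a contraction of a later one. -/
theorem exists_isContraction_of_wellQuasiOrderedLE {H : FinGraph}
    (h : WellQuasiOrderedLE (connectedContractionFree H)) (F : ℕ → FinGraph)
    (hconn : ∀ n, (F n).graph.Connected) (hF : ∀ m n, m < n → ¬ IsContraction (F m) (F n)) :
    ∃ n, IsContraction H (F n) := by
  by_contra! hcon
  obtain ⟨m, n, hmn, hle⟩ := h.wqo fun n => ⟨F n, hconn n, hcon n⟩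
  exact hF m n hmn hle

theorem exists_adj_of_card_lt {V W : Type} [Finite W] {G : SimpleGraph V}
    {K : SimpleGraph W} {φ : V → W} (hφ : IsContractionMap G K φ)
    (hcard : Nat.card W < Nat.card V) : ∃ x y, G.Adj x y ∧ φ x = φ y := by
  by_contra! hcon
  refine hcard.not_ge (Nat.card_le_card_of_injective φ fun x y hxy => ?_)
  refine (hφ.conn x y hxy).of_adj_closed (p := fun z => x = z) ?_ rfl
  rintro a b hab rfl
  exact (hcon _ _ hab.1 hab.2).elim

/-- A proper contraction of `K_{2,n}` has one or two universal vertices, and the other vertices are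
pairwise nonadjacent. -/
theorem structure_of_contraction_completeBipartiteGraph {n : ℕ} {W : Type} [Finite W]
    {K : SimpleGraph W} {φ : Bool ⊕ Fin n → W}
    (hφ : IsContractionMap (completeBipartiteGraph Bool (Fin n)) K φ) (hcard : Nat.card W < n + 2) :
    ∃ p q, (∀ v, v ≠ p → K.Adj p v) ∧ (∀ v, v ≠ q → K.Adj q v) ∧
      ∀ u v, u ≠ p → u ≠ q → v ≠ p → v ≠ q → ¬ K.Adj u v := by
  -- A contracted edge joins the two sides, and the merged vertex inherits the neighbours of both
  -- its ends, so it is universal.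
  obtain ⟨s, i, hsi⟩ : ∃ s i, φ (.inl s) = φ (.inr i) := by
    obtain ⟨x, y, hxy, h⟩ := exists_adj_of_card_lt hφ (by simpa [add_comm] using hcard)
    rcases x with s | i <;> rcases y with t | j
    · simp at hxy
    · exact ⟨s, j, h⟩
    · exact ⟨t, i, h.symm⟩
    · simp at hxy
  have hp : ∀ v, v ≠ φ (.inl s) → K.Adj (φ (.inl s)) v := by
    intro v hv
    obtain ⟨x, rfl⟩ := hφ.surj v
    rcases x with t | j
    · rw [hsi] at hv ⊢
      exact hφ.map_adj _ _ (by simp) hv.symm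
    · exact hφ.map_adj _ _ (by simp) hv.symm
  have hright : ∀ v, v ≠ φ (.inl s) → v ≠ φ (.inl !s) → ∀ x, φ x = v → ∃ j, x = .inr j := by
    rintro v hv hv' (t | j) hx
    · cases s <;> cases t <;> simp_all
    · exact ⟨j, rfl⟩
  refine ⟨φ (.inl s), φ (.inl !s), hp, fun v hv => ?_, fun u v hu hu' hv hv' huv => ?_⟩
  · by_cases hvp : v = φ (.inl s)
    · rw [hvp]
      exact (hp _ fun e => hv (hvp.trans e.symm)).symm
    · obtain ⟨x, hx⟩ := hφ.surj v
      obtain ⟨j, rfl⟩ := hright v hvp hv x hx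
      rw [← hx] at hv ⊢
      exact hφ.map_adj _ _ (by simp) hv.symm
  · obtain ⟨x, y, hx, hy, hxy⟩ := hφ.lift_adj u v huv
    obtain ⟨i, rfl⟩ := hright u hu hu' x hx
    obtain ⟨j, rfl⟩ := hright v hv hv' y hy
    simp at hxy

theorem connected_completeBipartiteGraph {n : ℕ} (hn : 0 < n) :
    (completeBipartiteGraph Bool (Fin n)).Connected := by
  have h : ∀ s i, (completeBipartiteGraph Bool (Fin n)).Reachable (.inl s) (.inr i) :=
    fun s i => Adj.reachable (by simp)
  rw [connected_iff_exists_forall_reachable]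
  refine ⟨.inl true, ?_⟩
  rintro (s | i)
  · exact (h true ⟨0, hn⟩).trans (h s ⟨0, hn⟩).symm
  · exact h true i

/-- A proper contraction of `K_{2,n}` has a universal vertex, whereas `K_{2,m}` with `m ≥ 2` has
none. -/
theorem not_isContraction_completeBipartiteGraph {m n : ℕ} (hm : 2 ≤ m) (hmn : m < n) :
    ¬ IsContraction ⟨_, completeBipartiteGraph Bool (Fin m)⟩
      ⟨_, completeBipartiteGraph Bool (Fin n)⟩ := by
  rw [isContraction_iff]
  rintro ⟨φ, hφ⟩
  obtain ⟨p, -, hp, -⟩ := structure_of_contraction_completeBipartiteGraph hφ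
    (by simpa [add_comm] using hmn)
  rcases p with s | i
  · have := hp (.inl !s) (by simp)
    simp at this
  · have : Nontrivial (Fin m) := Fin.nontrivial_iff_two_le.2 hm
    obtain ⟨j, hj⟩ := exists_ne i
    have := hp (.inr j) (by simpa using hj)
    simp at this

theorem coreGraph_true_adj {k : ℕ} (hk : k ≠ 0) (i j : Fin (k + 1)) :
    (coreGraph True k).Adj i j ↔ i.val + 1 = j ∨ j.val + 1 = i ∨ (i.val = 0 ∧ j.val = k) ∨
      (i.val = k ∧ j.val = 0) := by
  refine ⟨fun h => h.2 trivial, fun h => ⟨?_, fun _ => h⟩⟩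
  rintro rfl
  omega

/-- On a cycle with at least five vertices, two consecutive vertices have a common nonneighbour,
which joins them in the complement. -/
theorem connected_compl_coreGraph {k : ℕ} (hk : 4 ≤ k) : (coreGraph True k)ᶜ.Connected := by
  have key : ∀ x y : Fin (k + 1), (x.val + 1 = y ∨ (x.val = 0 ∧ y.val = k)) →
      (coreGraph True k)ᶜ.Reachable x y := by
    intro x y hxy
    obtain ⟨z, hz⟩ : ∃ z : Fin (k + 1), (coreGraph True k)ᶜ.Adj x z ∧
        (coreGraph True k)ᶜ.Adj z y := by
      simp only [compl_adj, coreGraph_true_adj (show k ≠ 0 by omega), Ne, Fin.ext_iff]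
      rcases hxy with h | h
      · by_cases h' : y.val + 2 ≤ k
        · exact ⟨⟨y.val + 2, by omega⟩, by dsimp only; omega⟩
        · exact ⟨⟨x.val - 2, by omega⟩, by dsimp only; omega⟩
      · exact ⟨⟨2, by omega⟩, by dsimp only; omega⟩
    exact hz.1.reachable.trans hz.2.reachable
  refine ⟨fun x y => ?_⟩
  by_cases hxy : x = y
  · rw [hxy]
  by_cases hadj : (coreGraph True k).Adj x y
  · rcases hadj.2 trivial with h | h | h | h
    · exact key x y (Or.inl h)
    · exact (key y x (Or.inl h)).symm
    · exact key x y (Or.inr h)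
    · exact (key y x (Or.inr h.symm)).symm
  · exact Adj.reachable ⟨hxy, hadj⟩

/-- Preimages of nonadjacent vertices are nonadjacent. -/
theorem adj_of_contraction_compl {V W : Type} {G : SimpleGraph V} {K : SimpleGraph W} {φ : V → W}
    (hφ : IsContractionMap Gᶜ K φ) {x y : V} (hne : φ x ≠ φ y) (h : ¬ K.Adj (φ x) (φ y)) :
    G.Adj x y := by
  by_contra hadj
  exact h (hφ.map_adj x y ⟨fun e => hne (congrArg φ e), hadj⟩ hne)

/-- A proper contraction merges some `x ≠ y`. Their image misses two vertices in the smaller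
complement; preimages `a` and `b` of these are cycle neighbours of both `x` and `y`. That is a
4-cycle inside a longer cycle. -/
theorem not_isContraction_compl_coreGraph {m n : ℕ} (hm : 4 ≤ m) (hmn : m < n) :
    ¬ IsContraction ⟨_, (coreGraph True m)ᶜ⟩ ⟨_, (coreGraph True n)ᶜ⟩ := by
  rw [isContraction_iff]
  rintro ⟨φ, hφ⟩
  dsimp only at φ hφ
  obtain ⟨x, y, hxy, h⟩ := exists_adj_of_card_lt hφ (by simpa using hmn)
  obtain ⟨u, w, huw, hu, hw⟩ : ∃ u w, u ≠ w ∧ (coreGraph True m).Adj (φ x) u ∧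
      (coreGraph True m).Adj (φ x) w := by
    generalize φ x = p
    simp only [coreGraph_true_adj (show m ≠ 0 by omega), Ne, Fin.ext_iff]
    by_cases h0 : p.val = 0
    · exact ⟨⟨1, by omega⟩, ⟨m, by omega⟩, by dsimp only; omega⟩
    by_cases h1 : p.val = m
    · exact ⟨⟨0, by omega⟩, ⟨m - 1, by omega⟩, by dsimp only; omega⟩
    · exact ⟨⟨p.val - 1, by omega⟩, ⟨p.val + 1, by omega⟩, by dsimp only; omega⟩
  obtain ⟨a, rfl⟩ := hφ.surj u
  obtain ⟨b, rfl⟩ := hφ.surj w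
  have hab : a ≠ b := fun e => huw (congrArg φ e)
  have h1 := adj_of_contraction_compl hφ hu.ne (fun h' => h'.2 hu)
  have h2 := adj_of_contraction_compl hφ hw.ne (fun h' => h'.2 hw)
  rw [h] at hu hw
  have h3 := adj_of_contraction_compl hφ hu.ne (fun h' => h'.2 hu)
  have h4 := adj_of_contraction_compl hφ hw.ne (fun h' => h'.2 hw)
  have hxy := hxy.ne
  rw [coreGraph_true_adj (by omega)] at h1 h2 h3 h4
  rw [Ne, Fin.ext_iff] at hxy hab
  omega

/-- Among three vertices of a contraction of the complement of a long cycle, two are adjacent. -/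
theorem exists_adj_of_contraction_compl_coreGraph {k : ℕ} (hk : 4 ≤ k) {W : Type}
    {K : SimpleGraph W} {φ : Fin (k + 1) → W} (hφ : IsContractionMap (coreGraph True k)ᶜ K φ)
    {u v w : W} (huv : u ≠ v) (huw : u ≠ w) (hvw : v ≠ w) :
    K.Adj u v ∨ K.Adj u w ∨ K.Adj v w := by
  by_contra! h
  obtain ⟨x, rfl⟩ := hφ.surj u
  obtain ⟨y, rfl⟩ := hφ.surj v
  obtain ⟨z, rfl⟩ := hφ.surj w
  -- Preimages of three independent vertices would form a triangle in a cycle of length at least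
  -- five.
  have h1 := adj_of_contraction_compl hφ huv h.1
  have h2 := adj_of_contraction_compl hφ huw h.2.1
  have h3 := adj_of_contraction_compl hφ hvw h.2.2
  rw [coreGraph_true_adj (by omega)] at h1 h2 h3
  omega

/-- Lists the at most two vertices other than `p` and `q`, with `p` as the default for missing ones,
so that four labels, possibly repeated, cover the graph. -/
theorem exists_pair_cover {W : Type} (p q : W)
    (h3 : ∀ u v w : W, u ≠ p → u ≠ q → v ≠ p → v ≠ q → w ≠ p → w ≠ q →
      u = v ∨ u = w ∨ v = w) :
    ∃ s t, (∀ v, v = s ∨ v = t ∨ v = p ∨ v = q) ∧ (s = t → s = p) ∧ (s = p ∨ s ≠ p ∧ s ≠ q) ∧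
      (t = p ∨ t ≠ p ∧ t ≠ q) := by
  by_cases hs : ∃ s, s ≠ p ∧ s ≠ q
  · obtain ⟨s, hsp, hsq⟩ := hs
    by_cases ht : ∃ t, t ≠ p ∧ t ≠ q ∧ t ≠ s
    · obtain ⟨t, htp, htq, hts⟩ := ht
      refine ⟨s, t, fun v => ?_, fun e => (hts e.symm).elim, Or.inr ⟨hsp, hsq⟩,
        Or.inr ⟨htp, htq⟩⟩
      by_contra! hv
      have := h3 s t v hsp hsq htp htq hv.2.2.1 hv.2.2.2
      grind
    · push Not at ht
      refine ⟨s, p, fun v => ?_, id, Or.inr ⟨hsp, hsq⟩, Or.inl rfl⟩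
      have := ht v
      tauto
  · push Not at hs
    exact ⟨p, p, fun v => by have := hs v; tauto, fun _ => rfl, Or.inl rfl, Or.inl rfl⟩

/-- A graph with one or two universal vertices and at most two further vertices, which are not
adjacent, is a contraction of the diamond. -/
theorem isContraction_diamond_of_universal {W : Type} [Finite W] {K : SimpleGraph W} {p q : W}
    (hp : ∀ v, v ≠ p → K.Adj p v) (hq : ∀ v, v ≠ q → K.Adj q v)
    (hind : ∀ u v, u ≠ p → u ≠ q → v ≠ p → v ≠ q → ¬ K.Adj u v)
    (h3 : ∀ u v w : W, u ≠ p → u ≠ q → v ≠ p → v ≠ q → w ≠ p → w ≠ q →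
      u = v ∨ u = w ∨ v = w) :
    IsContraction ⟨W, K⟩ diamond := by
  obtain ⟨s, t, hcov, hst, hs, ht⟩ := exists_pair_cover p q h3
  rw [isContraction_iff]
  let φ : Fin 4 → W := ![s, t, p, q]
  have hadj : ∀ i j : Fin 4, diamond.graph.Adj i j ↔ i ≠ j ∧ s(i, j) ≠ s(0, 1) := diamond_adj
  have h02 : diamond.graph.Adj (0 : Fin 4) (2 : Fin 4) := (hadj 0 2).2 (by decide)
  have h12 : diamond.graph.Adj (1 : Fin 4) (2 : Fin 4) := (hadj 1 2).2 (by decide)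
  have hcases : ∀ i j : Fin 4, i = j ∨ diamond.graph.Adj i j ∨ (i = 0 ∧ j = 1) ∨
      (i = 1 ∧ j = 0) := by
    intro i j
    rw [hadj]
    revert i j
    decide
  refine ⟨φ, fun v => ?_, fun i j hij => ?_, fun i j h hne => ?_, fun u v huv => ?_⟩
  · rcases hcov v with rfl | rfl | rfl | rfl
    · exact ⟨(0 : Fin 4), rfl⟩
    · exact ⟨(1 : Fin 4), rfl⟩
    · exact ⟨(2 : Fin 4), rfl⟩
    · exact ⟨(3 : Fin 4), rfl⟩
  -- The only nonadjacent pair of the diamond is `0`, `1`. If these are identified, both go to `p`,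
  -- and vertex `2` connects them in the fibre.
  · have h01 : φ 0 = φ 1 → (diamond.graph.fiberGraph φ).Reachable (0 : Fin 4) (1 : Fin 4) := by
      intro e
      have e0 : φ 0 = φ 2 := hst e
      have h₁ : (diamond.graph.fiberGraph φ).Adj (0 : Fin 4) (2 : Fin 4) := ⟨h02, e0⟩
      have h₂ : (diamond.graph.fiberGraph φ).Adj (2 : Fin 4) (1 : Fin 4) :=
        ⟨h12.symm, e0.symm.trans e⟩
      exact h₁.reachable.trans h₂.reachable
    rcases hcases i j with rfl | h | ⟨rfl, rfl⟩ | ⟨rfl, rfl⟩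
    · rfl
    · exact Adj.reachable ⟨h, hij⟩
    · exact h01 hij
    · exact (h01 hij.symm).symm
  · have hpq : ∀ i j : Fin 4, diamond.graph.Adj i j → (i = 2 ∨ i = 3) ∨ (j = 2 ∨ j = 3) := by
      intro i j
      rw [hadj]
      revert i j
      decide
    rcases hpq i j h with (rfl | rfl) | (rfl | rfl)
    · exact hp _ hne.symm
    · exact hq _ hne.symm
    · exact (hp _ hne).symm
    · exact (hq _ hne).symm
  · have hidx : ∀ v, ∃ i : Fin 4, φ i = v := by
      intro v
      rcases hcov v with rfl | rfl | rfl | rfl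
      · exact ⟨0, rfl⟩
      · exact ⟨1, rfl⟩
      · exact ⟨2, rfl⟩
      · exact ⟨3, rfl⟩
    have hst' : K.Adj s t → ∃ i j : Fin 4, φ i = s ∧ φ j = t ∧ diamond.graph.Adj i j := by
      intro h
      rcases hs with hs | hs
      · exact ⟨2, 1, hs.symm, rfl, h12.symm⟩
      · rcases ht with ht | ht
        · exact ⟨0, 2, rfl, ht.symm, h02⟩
        · exact (hind s t hs.1 hs.2 ht.1 ht.2 h).elim
    obtain ⟨i, rfl⟩ := hidx u
    obtain ⟨j, rfl⟩ := hidx v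
    rcases hcases i j with rfl | h | ⟨rfl, rfl⟩ | ⟨rfl, rfl⟩
    · exact (K.loopless.irrefl _ huv).elim
    · exact ⟨i, j, rfl, rfl, h⟩
    · exact hst' huv
    · obtain ⟨i, j, hi, hj, h⟩ := hst' huv.symm
      exact ⟨j, i, hj, hi, h.symm⟩

theorem isContraction_diamond_of_wellQuasiOrderedLE {H : FinGraph}
    (h : WellQuasiOrderedLE (connectedContractionFree H)) : IsContraction H diamond := by
  obtain ⟨n, hn⟩ := exists_isContraction_of_wellQuasiOrderedLE h
    -- The summand `Nat.card H.V` makes the contraction onto `H` proper; the summand `2` rules out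
    -- `K_{2,0}` and `K_{2,1}`.
    (fun n => ⟨_, completeBipartiteGraph Bool (Fin (n + 2 + Nat.card H.V))⟩)
    (fun n => connected_completeBipartiteGraph (by omega))
    fun m n hmn => not_isContraction_completeBipartiteGraph (by omega) (by omega)
  obtain ⟨k, hk⟩ := exists_isContraction_of_wellQuasiOrderedLE h
    (fun n => ⟨_, (coreGraph True (n + 4))ᶜ⟩)
    (fun n => connected_compl_coreGraph (by omega))
    fun m n hmn => not_isContraction_compl_coreGraph (by omega) (by omega)
  obtain ⟨φ, hφ⟩ := isContraction_iff.1 hn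
  obtain ⟨ψ, hψ⟩ := isContraction_iff.1 hk
  obtain ⟨p, q, hp, hq, hind⟩ := structure_of_contraction_completeBipartiteGraph hφ (by omega)
  refine isContraction_diamond_of_universal hp hq hind
    fun u v w hu hu' hv hv' hw hw' => ?_
  by_contra! hne
  rcases exists_adj_of_contraction_compl_coreGraph (by omega) hψ hne.1 hne.2.1 hne.2.2 with
    h | h | h
  · exact hind u v hu hu' hv hv' h
  · exact hind u w hu hu' hw hw' h
  · exact hind v w hv hv' hw hw' h

end FinGraph

theorem theorem1p5 (H : FinGraph) :
    WellQuasiOrderedLE (FinGraph.connectedContractionFree H) ↔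
      FinGraph.IsContraction H FinGraph.diamond :=
  ⟨FinGraph.isContraction_diamond_of_wellQuasiOrderedLE,
    FinGraph.wellQuasiOrderedLE_of_isContraction_diamond⟩
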